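/- **Setting.** Let $k_1,\dots,k_L$ be loop momenta, $p_1,\dots,p_n$ ($n=E-1$) the independent external momenta, and let a family of $p$ propagators be given by momenta $q_a=\sum_i\alpha_{ai}k_i+\sum_j\beta_{aj}p_j$ with $\alpha_{ai},\beta_{aj}\in\{-1,0,1\}$, and squared masses $m_a^2\ge 0$. The external scales are $x=(\{p_i\cdot p_j\},\{m_a^2\})$, with real values. The family is *complete* if every dot product $k_i\cdot k_j$, $k_i\cdot p_j$ is, identically, a linear combination of $1$ and the inverse propagators $m_a^2-q_a^2$ with coefficients that are polynomials over $\mathbb{Q}$ in $x$. For $\nu\in\mathbb{Z}^p$ and $\delta>0$ put $F_{\nu}=\prod_a(m_a^2-q_a^2-i\delta)^{-\nu_a}$. In dimension $D=D_0-2\epsilon$ (with $D_0\in\mathbb{N}$, $\epsilon\in\mathbb{C}$), the integral $I_\delta(x;\nu;D)=\int\prod_{j}e^{\gamma_E\epsilon}\frac{d^Dk_j}{i\pi^{D/2}}F_\nu$ is defined for $\operatorname{Re}\epsilon\gg0$ by its Schwinger parametrisation $$e^{\gamma_EL\epsilon}\,i^{-LD/2}\int_{(0,\infty)^{\{a:\nu_a>0\}}}\prod_{\nu_a>0}\frac{i^{\nu_a}\alpha_a^{\nu_a-1}d\alpha_a}{\Gamma(\nu_a)}\Big[\prod_{\nu_a\le0}\big(i\,\partial_{\alpha_a}\big)^{-\nu_a}\,\mathcal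 U^{-D/2}e^{-i\mathcal F/\mathcal U}\Big]_{\alpha_a=0\ (\nu_a\le0)},$$ where $\mathcal U,\mathcal F$ are the Symanzik polynomials, with $m_a^2-i\delta$ in place of $m_a^2$: writing $\sum_a\alpha_aq_a^2=k^TAk+2k^TBp+p^TCp$, one has $\mathcal U=\det A$ and $\mathcal F=\mathcal U\sum_a\alpha_a(m_a^2-i\delta)-\sum_{j,l}(\mathcal UC-B^T\operatorname{adj}(A)B)_{jl}\,p_j\cdot p_l$; where $\mathcal U\le 0$ the function $\mathcal U^{-D/2}e^{-i\mathcal F/\mathcal U}$ is read as $0$. The integral $I_\delta$ is continued meromorphically in $\epsilon$. The dimensionally regularised Feynman integral $I(x;\nu;D)$ is the meromorphic function of $\epsilon\in\mathbb{C}$ that equals $\lim_{\delta\to0^+}I_\delta(x;\nu;D)$ for all non-real $\epsilon$ with $\operatorname{Re}\epsilon\ll0$. **Proposition.** Let the family be complete. Let $D_0\in\mathbb{N}$, $1\le i\le L$ and $v\in\{k_1,\dots,k_L,p_1,\dots,p_n\}$. Then there are polynomials $c_s\in\mathbb{Q}[x,\nu,\epsilon]$, $s\in\mathbb{Z}^p$,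 only finitely many of them nonzero but not all zero, with the following properties. In particular the $c_s$ are rational functions of $x$ and $\epsilon$. 1. (Total derivative.) For every integer dimension $d\ge 0$, all vectors $k_1,\dots,k_L,p_1,\dots,p_n$ of $d$-dimensional Minkowski space, all $m_a^2\ge0$, $\delta>0$ and $\nu\in\mathbb{Z}^p$, $$\sum_\mu\frac{\partial}{\partial k_i^\mu}\big[v^\mu F_\nu\big]=\sum_s c_s\,F_{\nu+s},$$ where $c_s$ is evaluated at $\nu$, at the dot products $p_j\cdot p_l$, at $m_a^2-i\delta$ in place of $m_a^2$, and at $\epsilon=(D_0-d)/2$. 2. (IBP relation for convergent integrals.) For all real scales $x$ with $m_a^2\ge0$, all $\nu\in\mathbb{Z}^p$ and $\delta>0$, there is $R$ such that for all $\epsilon$ with $\operatorname{Re}\epsilon>R$ the Schwinger parametrisations of $I_\delta(x;\nu+s;D)$ with $c_s\neq0$ converge absolutely, and $\sum_s c_s\,I_\delta(x;\nu+s;D)=0$, with $c_s$ evaluated at $\nu$, $\epsilon$, and $x$ with $m_a^2-i\delta$ in place of $m_a^2$. 3. (IBP relation in dimensional regularisation.) For all real scales $x$ with $m_a^2\ge0$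 and all $\nu\in\mathbb{Z}^p$ such that the dimensionally regularised integrals $I(x;\nu+s;D)$ with $c_s\ne0$ exist, $$\sum_s c_s(x,\nu,\epsilon)\,I(x;\nu+s;D_0-2\epsilon)=0$$ at every $\epsilon$ at which all these integrals are analytic. -/

import Mathlib

open scoped Topology

namespace Feynman

noncomputable section

/-- Labels of the momenta `t_1, …, t_K` of a family with `L` loop momenta (`Sum.inl i` is `k_i`)
and `n = E - 1` independent external momenta (`Sum.inr j` is `p_j`). -/
abbrev Mom (L n : ℕ) : Type := Fin L ⊕ Fin n

/-- Labels of the external scales: `Sum.inl s(i, j)` is the dot product `p_i · p_j` and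
`Sum.inr a` is the squared mass `m_a ^ 2`. -/
abbrev Scale (n p : ℕ) : Type := Sym2 (Fin n) ⊕ Fin p

/-- A family of `p` propagators: the momentum of propagator `a` is
`q_a = ∑ t, coeff a t • t`, over loop and independent external momenta `t`. -/
structure Family (L n p : ℕ) where
  coeff : Fin p → Mom L n → ℤ
  coeff_mem : ∀ a t, coeff a t ∈ ({-1, 0, 1} : Set ℤ)

variable {L n p : ℕ}

/-! ### Inverse propagators and completeness -/

/-- The inverse propagator `m_a ^ 2 - q_a ^ 2`, as a polynomial in the formal dot products of all
the momenta (`Sum.inl s(t, u)` is `t · u`) and the squared masses (`Sum.inr a`). -/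
def Family.invProp (F : Family L n p) (a : Fin p) :
    MvPolynomial (Sym2 (Mom L n) ⊕ Fin p) ℚ :=
  MvPolynomial.X (Sum.inr a) - ∑ t, ∑ u,
    MvPolynomial.C ((F.coeff a t : ℚ) * (F.coeff a u : ℚ)) * MvPolynomial.X (Sum.inl s(t, u))

/-- A polynomial in the external scales, as a polynomial in all dot products and masses. -/
def ofScales (L : ℕ) (r : MvPolynomial (Scale n p) ℚ) :
    MvPolynomial (Sym2 (Mom L n) ⊕ Fin p) ℚ :=
  MvPolynomial.rename (Sum.map (Sym2.map (Sum.inr : Fin n → Mom L n)) id) r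

/-- A family is complete if every dot product involving at least one loop momentum can be
expressed through the inverse propagators, with coefficients that are polynomials in the external
scales. -/
def Family.IsComplete (F : Family L n p) : Prop :=
  ∀ (i : Fin L) (t : Mom L n),
    ∃ (l : Fin p → MvPolynomial (Scale n p) ℚ) (r : MvPolynomial (Scale n p) ℚ),
      (MvPolynomial.X (Sum.inl s(Sum.inl i, t)) : MvPolynomial (Sym2 (Mom L n) ⊕ Fin p) ℚ) =
        ∑ a, ofScales L (l a) * F.invProp a + ofScales L r

/-! ### The integrand in momentum space and its total derivatives -/

/-- The Minkowski product on `ℝ ^ d`, with signature `(+, -, …, -)`. -/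
def mdot {d : ℕ} (u v : Fin d → ℝ) : ℝ :=
  ∑ μ : Fin d, (if (μ : ℕ) = 0 then 1 else -1) * (u μ * v μ)

theorem mdot_comm {d : ℕ} (u v : Fin d → ℝ) : mdot u v = mdot v u := by
  simp only [mdot, mul_comm]

/-- The external scales of a configuration of external momenta `P` and squared masses `m2`. -/
def scalesOf {d : ℕ} (P : Fin n → Fin d → ℝ) (m2 : Fin p → ℝ) : Scale n p → ℝ :=
  Sum.elim (Sym2.lift ⟨fun i j => mdot (P i) (P j), fun _ _ => mdot_comm _ _⟩) m2

/-- The Feynman prescription: `m_a ^ 2` is replaced by `m_a ^ 2 - i δ`. -/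
def shiftScales (x : Scale n p → ℝ) (δ : ℝ) : Scale n p → ℂ :=
  Sum.elim (fun e => (x (Sum.inl e) : ℂ)) (fun a => (x (Sum.inr a) : ℂ) - Complex.I * δ)

/-- The momentum `q_a` flowing through propagator `a`. -/
def Family.q (F : Family L n p) {d : ℕ} (k : Fin L → Fin d → ℝ) (P : Fin n → Fin d → ℝ)
    (a : Fin p) : Fin d → ℝ :=
  ∑ t, (F.coeff a t : ℝ) • Sum.elim k P t

/-- The integrand `∏ a, (m_a ^ 2 - q_a ^ 2 - i δ) ^ (-ν_a)`. -/
def Family.integrand (F : Family L n p) {d : ℕ} (P : Fin n → Fin d → ℝ) (m2 : Fin p → ℝ)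
    (δ : ℝ) (ν : Fin p → ℤ) (k : Fin L → Fin d → ℝ) : ℂ :=
  ∏ a, (((m2 a - mdot (F.q k P a) (F.q k P a) : ℝ) : ℂ) - Complex.I * δ) ^ (-ν a)

/-- The total derivative `∑ μ, ∂ / ∂ k_i ^ μ [v ^ μ f]`, where `v` is the loop or external
momentum labelled by `t` and `f` is a function of the loop momenta. -/
def totalDerivative {d : ℕ} (P : Fin n → Fin d → ℝ) (i : Fin L) (t : Mom L n)
    (f : (Fin L → Fin d → ℝ) → ℂ) (k : Fin L → Fin d → ℝ) : ℂ :=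
  ∑ μ, deriv (fun s : ℝ =>
    ((Sum.elim (Function.update k i (Function.update (k i) μ s)) P t μ : ℝ) : ℂ) *
      f (Function.update k i (Function.update (k i) μ s))) (k i μ)

/-! ### Dimensionally regularised Feynman integrals

The `D`-dimensional integral is defined through Schwinger parameters. With
`(z - i δ)⁻ᵛ = iᵛ / Γ(v) * ∫ α in (0, ∞), α ^ (v - 1) * exp (-i α (z - i δ))` for `v > 0`,
`z ^ m = (i ∂ / ∂ α) ^ m exp (-i α z)` at `α = 0`, and the Gaussian integral
`∫ ∏ dᴰk_j / (i π ^ (D / 2)) exp (-i ∑ α_a (m_a ^ 2 - q_a ^ 2))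
  = i ^ (-L D / 2) * U ^ (-D / 2) * exp (-i F / U)`,
the momenta disappear and `D` becomes a complex parameter. -/

/-- The `L × L` matrix of the quadratic form `∑ a, α_a q_a ^ 2` in the loop momenta. -/
def Family.loopMatrix (F : Family L n p) (α : Fin p → ℝ) : Matrix (Fin L) (Fin L) ℝ :=
  Matrix.of fun i j => ∑ a, α a * (F.coeff a (Sum.inl i) * F.coeff a (Sum.inl j))

/-- The mixed part of `∑ a, α_a q_a ^ 2`. -/
def Family.mixedMatrix (F : Family L n p) (α : Fin p → ℝ) : Matrix (Fin L) (Fin n) ℝ :=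
  Matrix.of fun i j => ∑ a, α a * (F.coeff a (Sum.inl i) * F.coeff a (Sum.inr j))

/-- The part of `∑ a, α_a q_a ^ 2` that is quadratic in the external momenta. -/
def Family.extMatrix (F : Family L n p) (α : Fin p → ℝ) : Matrix (Fin n) (Fin n) ℝ :=
  Matrix.of fun i j => ∑ a, α a * (F.coeff a (Sum.inr i) * F.coeff a (Sum.inr j))

/-- The first Symanzik polynomial `U`. -/
def Family.symanzikU (F : Family L n p) (α : Fin p → ℝ) : ℝ := (F.loopMatrix α).det

/-- The second Symanzik polynomial `F = U * ∑ a, m_a ^ 2 α_a + F'`, where `F'` does not depend on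
the masses. -/
def Family.symanzikF (F : Family L n p) (x : Scale n p → ℂ) (α : Fin p → ℝ) : ℂ :=
  (F.symanzikU α : ℂ) * ∑ a, x (Sum.inr a) * (α a : ℂ) -
    ∑ i, ∑ j, (((F.symanzikU α • F.extMatrix α -
      (F.mixedMatrix α).transpose * (F.loopMatrix α).adjugate * F.mixedMatrix α) i j : ℝ) : ℂ) *
        x (Sum.inl s(i, j))

/-- The Gaussian factor `U ^ (-D / 2) * exp (-i F / U)`. In the closed positive orthant `U ≥ 0`;
where `U` does not exceed `0` the value is `0`. -/
def Family.gaussian (F : Family L n p) (x : Scale n p → ℂ) (D : ℂ) (α : Fin p → ℝ) : ℂ :=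
  if 0 < F.symanzikU α then
    (F.symanzikU α : ℂ) ^ (-D / 2) *
      Complex.exp (-Complex.I * F.symanzikF x α / (F.symanzikU α : ℂ))
  else 0

/-- The operator `i ∂ / ∂ α_a`, which inserts the inverse propagator `a` into the integrand. -/
def insertProp (a : Fin p) (f : (Fin p → ℝ) → ℂ) : (Fin p → ℝ) → ℂ :=
  fun α => Complex.I * deriv (fun s : ℝ => f (Function.update α a s)) (α a)

/-- Insertion of the numerator `∏ (m_a ^ 2 - q_a ^ 2) ^ (-ν_a)`, over all `a` with `ν_a ≤ 0`. -/
def insertNumerator (ν : Fin p → ℤ) (f : (Fin p → ℝ) → ℂ) : (Fin p → ℝ) → ℂ :=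
  (List.finRange p).foldr (fun a g => (insertProp a)^[(-ν a).toNat] g) f

/-- The point with Schwinger parameters `α_a` where `ν_a > 0`, and `0` where `ν_a ≤ 0`. -/
def extendZero (ν : Fin p → ℤ) (α : {a : Fin p // 0 < ν a} → ℝ) : Fin p → ℝ :=
  fun a => if h : 0 < ν a then α ⟨a, h⟩ else 0

/-- The integrand of the Schwinger parametrisation in dimension `D`, a function of the Schwinger
parameters of those propagators that have a positive exponent. -/
def Family.schwingerIntegrand (F : Family L n p) (x : Scale n p → ℂ) (ν : Fin p → ℤ) (D : ℂ)
    (α : {a : Fin p // 0 < ν a} → ℝ) : ℂ :=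
  (∏ a : {a : Fin p // 0 < ν a}, Complex.I ^ (ν a) * (α a : ℂ) ^ (ν a - 1) / Complex.Gamma (ν a)) *
    insertNumerator ν (F.gaussian x D) (extendZero ν α)

/-- The domain of integration of the Schwinger parameters. -/
def orthant (ν : Fin p → ℤ) : Set ({a : Fin p // 0 < ν a} → ℝ) := {α | ∀ a, 0 < α a}

/-- The Schwinger parametrisation of the Feynman integral with exponents `ν` in dimension
`D = D₀ - 2 ε`, with `x` the scales after the Feynman prescription. It converges when the real part
of `ε` is large. -/
def Family.schwinger (F : Family L n p) (D₀ : ℕ) (x : Scale n p → ℂ) (ν : Fin p → ℤ) (ε : ℂ) : ℂ :=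
  Complex.exp (Real.eulerMascheroniConstant * L * ε) *
    Complex.I ^ (-(L : ℂ) * (D₀ - 2 * ε) / 2) *
      ∫ α in orthant ν, F.schwingerIntegrand x ν (D₀ - 2 * ε) α

/-- `I` is the dimensionally regularised Feynman integral `I(x; ν; D₀ - 2 ε)` as a meromorphic
function of `ε`. For `δ > 0`, `J δ` is the meromorphic continuation of the integral with
`m_a ^ 2 - i δ` in place of `m_a ^ 2`, from the region where its Schwinger parametrisation
converges. The limit `δ → 0+` of the Feynman prescription is taken where the real part of the
dimension is large, so that there are neither infrared nor threshold divergences, and away from the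
real axis, on which the poles lie; `I` is its meromorphic continuation. -/
def Family.IsFeynmanIntegral (F : Family L n p) (D₀ : ℕ) (x : Scale n p → ℝ) (ν : Fin p → ℤ)
    (I : ℂ → ℂ) : Prop :=
  MeromorphicOn I Set.univ ∧
  ∃ J : ℝ → ℂ → ℂ,
    (∀ δ : ℝ, 0 < δ → MeromorphicOn (J δ) Set.univ ∧
      ∃ R : ℝ, ∀ ε : ℂ, R < ε.re → J δ ε = F.schwinger D₀ (shiftScales x δ) ν ε) ∧
    ∃ R : ℝ, ∀ ε : ℂ, ε.re < R → ε.im ≠ 0 →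
      (∀ᶠ δ in 𝓝[>] (0 : ℝ), AnalyticAt ℂ (J δ) ε) ∧
      Filter.Tendsto (fun δ => J δ ε) (𝓝[>] (0 : ℝ)) (𝓝 (I ε))

/-! ### Coefficients of recursion relations -/

/-- Polynomials with rational coefficients in the external scales, the exponents
`ν_1, …, ν_p` and the dimensional regulator `ε`, in this order. -/
abbrev Coeff (n p : ℕ) : Type := MvPolynomial (Scale n p ⊕ (Fin p ⊕ Unit)) ℚ

/-- The value of a coefficient at given scales, exponents and regulator. -/
def Coeff.eval (c : Coeff n p) (x : Scale n p → ℂ) (ν : Fin p → ℤ) (ε : ℂ) : ℂ :=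
  MvPolynomial.aeval (Sum.elim x (Sum.elim (fun a => (ν a : ℂ)) (fun _ => ε))) c

end

end Feynman

namespace Feynman

noncomputable section

variable {L n p : ℕ}

/-! ### Reduction of dot products and the coefficients of the relations -/

/-! In momentum space the relation is the product rule. The divergence of `v F_ν` in `k_i` is `d
F_ν` (only for `v = k_i`) plus the sum over `a` of `2 ν_a α_{ai} (v · q_a) F_{ν + e_a}`. Here `v ·
q_a` is a combination of dot products `v · t_u`, and completeness turns each of them into `∑ b, l_b
D_b + r`, where a factor `D_b` lowers the exponent `b` by one. Collecting terms, with `d` written as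
`D₀ - 2 ε`, gives `ibpCoeff`.

For complex `D` there are no momenta left to integrate over, so the same coefficients are tested on
the Schwinger side. Write `G = U ^ (-D/2) exp (-i F / U)`. By rank one updates of the quadratic
form, `i ∂_b G = G * ⟨D_b⟩`, where `⟨·⟩` replaces each dot product by its Gaussian expectation value
(`Family.insertProp_gaussian`). Completeness is an identity of polynomials in formal dot products,
so it may be evaluated at these expectation values, although no vectors realise them. Together with
`A A⁻¹ = 1` (`Family.sum_param_mul_gaussMean`) this gives a pointwise relation between `G`, `α_a G`
and `α_a i ∂_b G` (`Family.Reduces.expFun_ibpPoly`).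

Integration against the Schwinger weights translates operators into shifts: `i ∂_b` becomes `ν ↦ ν -
e_b` (`schwingerFunctional_insertProp`), and multiplication by `α_a` becomes `-i ν_a` times `ν ↦ ν +
e_a` (`schwingerFunctional_mulParam`). Both hold for exponents of either sign. Point masses at `0`
for the exponents `ν_a ≤ 0` put all these integrals on the same space `Fin p → ℝ`. The analysis is
carried by the class of functions `P U ^ z exp (-i V / U)` with `P` a polynomial: `i ∂_a` maps it to
itself, lowers `z` by `2` and acts linearly on `P`, and `δ > 0` supplies exponential decay.

In dimensional regularisation, the relation for fixed `δ` is continued meromorphically in `ε`, the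
limit `δ → 0+` is taken far to the left and off the real axis, and the result is continued once more
(`Family.relation_of_isFeynmanIntegral`). -/

/-- The polynomials `l`, `r` express every dot product of momenta through the inverse
propagators. -/
def Family.Reduces (F : Family L n p) (l : Mom L n → Mom L n → Fin p → MvPolynomial (Scale n p) ℚ)
    (r : Mom L n → Mom L n → MvPolynomial (Scale n p) ℚ) : Prop :=
  ∀ t u, (MvPolynomial.X (Sum.inl s(t, u)) : MvPolynomial (Sym2 (Mom L n) ⊕ Fin p) ℚ) =
    ∑ a, ofScales L (l t u a) * F.invProp a + ofScales L (r t u)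

theorem Family.IsComplete.exists_reduces {F : Family L n p} (hF : F.IsComplete) :
    ∃ l r, F.Reduces l r := by
  have key : ∀ t u : Mom L n, ∃ (l : Fin p → MvPolynomial (Scale n p) ℚ)
      (r : MvPolynomial (Scale n p) ℚ),
      (MvPolynomial.X (Sum.inl s(t, u)) : MvPolynomial (Sym2 (Mom L n) ⊕ Fin p) ℚ) =
        ∑ a, ofScales L (l a) * F.invProp a + ofScales L r := by
    rintro (i | j) u
    · exact hF i u
    -- Completeness covers pairs that contain a loop momentum, in either order; a purely external
    -- pair is itself a scale.
    · rcases u with i | j'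
      · rw [Sym2.eq_swap]
        exact hF i _
      · refine ⟨0, MvPolynomial.X (Sum.inl s(j, j')), ?_⟩
        simp [ofScales]
  choose l r h using key
  exact ⟨l, r, h⟩

/-- The value of the inverse propagator `a` when the dot products have the values `N` and the
squared masses the values `m`. -/
def Family.invPropValue (F : Family L n p) (N : Sym2 (Mom L n) → ℂ) (m : Fin p → ℂ) (a : Fin p) :
    ℂ :=
  m a - ∑ t, ∑ u, (F.coeff a t : ℂ) * (F.coeff a u : ℂ) * N s(t, u)

/-- Since the reduction is an identity of polynomials, the values `N` need not come from vectors.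
This freedom is used for true dot products, for Gaussian expectation values and for test values that
show the coefficients to be nonzero. -/
theorem Family.Reduces.eval {F : Family L n p} {l r} (h : F.Reduces l r)
    (N : Sym2 (Mom L n) → ℂ) (x : Scale n p → ℂ)
    (hN : ∀ e, N (Sym2.map Sum.inr e) = x (Sum.inl e)) (t u : Mom L n) :
    N s(t, u) = ∑ b, MvPolynomial.aeval x (l t u b) *
      F.invPropValue N (fun a => x (Sum.inr a)) b + MvPolynomial.aeval x (r t u) := by
  have h1 := congrArg (MvPolynomial.aeval (Sum.elim N (fun a => x (Sum.inr a)))) (h t u)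
  have h2 : (Sum.elim N (fun a => x (Sum.inr a))) ∘
      (Sum.map (Sym2.map (Sum.inr : Fin n → Mom L n)) id) = x := by
    funext e
    rcases e with e | e
    · simp [hN]
    · simp
  simpa [ofScales, MvPolynomial.aeval_rename, h2, Family.invProp, Family.invPropValue] using h1

/-- The coefficients of the recursion relation that comes from the total derivative with respect to
`k_i` in the direction of the momentum `t`. -/
def Family.ibpCoeff (F : Family L n p) (l : Mom L n → Mom L n → Fin p → MvPolynomial (Scale n p) ℚ)
    (r : Mom L n → Mom L n → MvPolynomial (Scale n p) ℚ) (D₀ : ℕ) (i : Fin L) (t : Mom L n) :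
    (Fin p → ℤ) →₀ Coeff n p :=
  (if t = Sum.inl i then Finsupp.single 0
    (MvPolynomial.C (D₀ : ℚ) - MvPolynomial.C 2 * MvPolynomial.X (Sum.inr (Sum.inr ()))) else 0) +
  ∑ a, ∑ u, ((∑ b, Finsupp.single (Pi.single a 1 - Pi.single b 1)
      (MvPolynomial.C (2 * (F.coeff a (Sum.inl i) : ℚ) * (F.coeff a u : ℚ)) *
        MvPolynomial.X (Sum.inr (Sum.inl a)) * MvPolynomial.rename Sum.inl (l t u b))) +
    Finsupp.single (Pi.single a 1)
      (MvPolynomial.C (2 * (F.coeff a (Sum.inl i) : ℚ) * (F.coeff a u : ℚ)) *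
        MvPolynomial.X (Sum.inr (Sum.inl a)) * MvPolynomial.rename Sum.inl (r t u)))

/-- Pairing of coefficients with a function of the shifts, as an additive map. -/
def pairing (x : Scale n p → ℂ) (ν : Fin p → ℤ) (ε : ℂ) (g : (Fin p → ℤ) → ℂ) :
    ((Fin p → ℤ) →₀ Coeff n p) →+ ℂ :=
  Finsupp.liftAddHom fun s => (AddMonoidHom.mulRight (g s)).comp
    (MvPolynomial.aeval (Sum.elim x (Sum.elim (fun a => (ν a : ℂ)) (fun _ => ε))) :
      Coeff n p →ₐ[ℚ] ℂ).toRingHom.toAddMonoidHom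

theorem sum_eval_eq_pairing (c : (Fin p → ℤ) →₀ Coeff n p) (x : Scale n p → ℂ) (ν : Fin p → ℤ)
    (ε : ℂ) (g : (Fin p → ℤ) → ℂ) :
    (c.sum fun s b => Coeff.eval b x ν ε * g s) = pairing x ν ε g c := rfl

theorem pairing_single (x : Scale n p → ℂ) (ν : Fin p → ℤ) (ε : ℂ) (g : (Fin p → ℤ) → ℂ)
    (s : Fin p → ℤ) (b : Coeff n p) :
    pairing x ν ε g (Finsupp.single s b) =
      MvPolynomial.aeval (Sum.elim x (Sum.elim (fun a => (ν a : ℂ)) (fun _ => ε))) b * g s := by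
  simp [pairing]

/-- Different terms of `ibpCoeff` can carry the same shift (every `a = b` gives `0`), so individual
coefficients are awkward. The pairing with an arbitrary function `g` of the shift is additive and is
the only access to them that is needed. -/
theorem Family.sum_ibpCoeff (F : Family L n p) (l r) (D₀ : ℕ) (i : Fin L) (t : Mom L n)
    (x : Scale n p → ℂ) (ν : Fin p → ℤ) (ε : ℂ) (g : (Fin p → ℤ) → ℂ) :
    ((F.ibpCoeff l r D₀ i t).sum fun s b => Coeff.eval b x ν ε * g s) =
      (if t = Sum.inl i then ((D₀ : ℂ) - 2 * ε) * g 0 else 0) +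
      ∑ a, ∑ u, 2 * (F.coeff a (Sum.inl i) : ℂ) * (F.coeff a u : ℂ) * (ν a : ℂ) *
        (∑ b, MvPolynomial.aeval x (l t u b) * g (Pi.single a 1 - Pi.single b 1) +
          MvPolynomial.aeval x (r t u) * g (Pi.single a 1)) := by
  rw [sum_eval_eq_pairing, Family.ibpCoeff, map_add]
  congr 1
  · split_ifs
    · rw [pairing_single]; simp
    · simp
  · have hinl : (Sum.elim x (Sum.elim (fun a => (ν a : ℂ)) (fun _ : Unit => ε))) ∘ Sum.inl = x := by
      funext e; simp
    simp only [map_sum, map_add, pairing_single, map_mul, MvPolynomial.aeval_rename, hinl,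
      MvPolynomial.aeval_X, Sum.elim_inr, Sum.elim_inl, MvPolynomial.aeval_C]
    refine Finset.sum_congr rfl fun a _ => Finset.sum_congr rfl fun u _ => ?_
    simp only [map_ofNat, map_intCast, mul_add, Finset.mul_sum]
    congr 1
    · refine Finset.sum_congr rfl fun b _ => ?_
      ring
    · ring

/-- If no propagator contained `k_i`, the right-hand side of the reduction of `k_i · k_i` would not
depend on the value `z` assigned to it. -/
theorem Family.Reduces.exists_coeff_ne_zero {F : Family L n p} {l r} (h : F.Reduces l r)
    (i : Fin L) : ∃ a, F.coeff a (Sum.inl i) ≠ 0 := by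
  by_contra! hc
  have key : ∀ z : ℂ, z = ∑ b, MvPolynomial.aeval (fun _ => (0 : ℂ)) (l (Sum.inl i) (Sum.inl i) b) *
      0 + MvPolynomial.aeval (fun _ => (0 : ℂ)) (r (Sum.inl i) (Sum.inl i)) := by
    intro z
    have h1 := h.eval (fun e => if e = s(Sum.inl i, Sum.inl i) then z else 0) (fun _ => 0) (by
      intro e
      induction e using Sym2.ind with
      | _ a b => simp) (Sum.inl i) (Sum.inl i)
    rw [if_pos rfl] at h1
    rw [h1]
    congr 1
    refine Finset.sum_congr rfl fun b _ => ?_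
    congr 1
    rw [Family.invPropValue, zero_sub, neg_eq_zero]
    refine Finset.sum_eq_zero fun t _ => Finset.sum_eq_zero fun u _ => ?_
    by_cases ht : s(t, u) = s(Sum.inl i, Sum.inl i)
    · have : t = Sum.inl i := by simpa using (Sym2.eq_iff.1 ht)|>.elim (·.1) (·.1)
      simp [this, hc]
    · rw [if_neg ht, mul_zero]
  exact one_ne_zero ((key 1).trans (key 0).symm)

theorem Family.Reduces.ibpCoeff_ne_zero {F : Family L n p} {l r} (h : F.Reduces l r) (D₀ : ℕ)
    (i : Fin L) (t : Mom L n) : F.ibpCoeff l r D₀ i t ≠ 0 := by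
  intro h0
  by_cases ht : t = Sum.inl i
  -- At `ν = 0` only the dimension term survives, and this value of `ε` makes the dimension equal to
  -- `1`.
  · have h1 := F.sum_ibpCoeff l r D₀ i t (fun _ => 0) 0 ((D₀ - 1) / 2) (fun _ => 1)
    rw [h0] at h1
    simp [ht] at h1
    have h2 : (0 : ℂ) = 1 := by linear_combination h1
    exact zero_ne_one h2
  · obtain ⟨a₀, ha₀⟩ := h.exists_coeff_ne_zero i
    -- The only nonzero dot product is `t · k_i`, and the masses are chosen so that every inverse
    -- propagator equals `1`. With `g = 1` each bracket then collapses to `N s(t, u)`, and `ν =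
    -- e_{a₀}` leaves the single term `2 α_{a₀ i} ^ 2`.
    let N : Sym2 (Mom L n) → ℂ := fun e => if e = s(t, Sum.inl i) then 1 else 0
    let x : Scale n p → ℂ := Sum.elim (fun e => N (Sym2.map Sum.inr e))
      (fun a => 1 + ∑ t, ∑ u, (F.coeff a t : ℂ) * (F.coeff a u : ℂ) * N s(t, u))
    have hP : ∀ b, F.invPropValue N (fun a => x (Sum.inr a)) b = 1 := fun b => by
      simp [Family.invPropValue, x]
    have h1 := F.sum_ibpCoeff l r D₀ i t x (Pi.single a₀ 1) 0 (fun _ => 1)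
    rw [h0, Finsupp.sum_zero_index, if_neg ht, zero_add] at h1
    have h2 : ∀ u, (∑ b, MvPolynomial.aeval x (l t u b) * 1 +
        MvPolynomial.aeval x (r t u) * 1) = N s(t, u) := fun u => by
      rw [h.eval N x (fun e => rfl) t u]
      simp [hP]
    simp only [h2] at h1
    rw [Finset.sum_eq_single a₀, Finset.sum_eq_single (Sum.inl i)] at h1
    · simp [N, ha₀] at h1
    · intro u _ hu
      have : N s(t, u) = 0 := by
        simp only [N]
        rw [if_neg]
        intro he
        exact hu (Sym2.congr_right.1 he)
      simp [this]
    · simp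
    · intro a _ ha
      simp [Pi.single_eq_of_ne ha]
    · simp

/-! ### The total derivative of the integrand -/

/-- Dot products of momenta, as a function of unordered pairs of labels. -/
def dotProducts {d : ℕ} (T : Mom L n → Fin d → ℝ) (e : Sym2 (Mom L n)) : ℂ :=
  ((Sym2.lift ⟨fun t u => mdot (T t) (T u), fun _ _ => mdot_comm _ _⟩ e : ℝ) : ℂ)

theorem mdot_sum_left {d : ℕ} {ι : Type*} (s : Finset ι) (f : ι → ℝ) (T : ι → Fin d → ℝ)
    (v : Fin d → ℝ) : mdot (∑ t ∈ s, f t • T t) v = ∑ t ∈ s, f t * mdot (T t) v := by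
  simp only [mdot, Finset.sum_apply, Pi.smul_apply, smul_eq_mul, Finset.mul_sum, Finset.sum_mul]
  rw [Finset.sum_comm]
  exact Finset.sum_congr rfl fun t _ => Finset.sum_congr rfl fun μ _ => by ring

theorem mdot_sum_right {d : ℕ} {ι : Type*} (s : Finset ι) (f : ι → ℝ) (T : ι → Fin d → ℝ)
    (v : Fin d → ℝ) : mdot v (∑ t ∈ s, f t • T t) = ∑ t ∈ s, f t * mdot v (T t) := by
  rw [mdot_comm, mdot_sum_left]
  exact Finset.sum_congr rfl fun t _ => by rw [mdot_comm]

/-- The denominator `m_a ^ 2 - q_a ^ 2 - i δ`. -/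
def Family.denom (F : Family L n p) {d : ℕ} (P : Fin n → Fin d → ℝ) (m2 : Fin p → ℝ) (δ : ℝ)
    (k : Fin L → Fin d → ℝ) (a : Fin p) : ℂ :=
  ((m2 a - mdot (F.q k P a) (F.q k P a) : ℝ) : ℂ) - Complex.I * δ

theorem Family.denom_ne_zero (F : Family L n p) {d : ℕ} (P : Fin n → Fin d → ℝ) (m2 : Fin p → ℝ)
    {δ : ℝ} (hδ : 0 < δ) (k : Fin L → Fin d → ℝ) (a : Fin p) : F.denom P m2 δ k a ≠ 0 := by
  intro h
  have := congrArg Complex.im h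
  simp [Family.denom] at this
  exact hδ.ne' this

theorem Family.invPropValue_dotProducts (F : Family L n p) {d : ℕ} (P : Fin n → Fin d → ℝ)
    (m2 : Fin p → ℝ) (δ : ℝ) (k : Fin L → Fin d → ℝ) (a : Fin p) :
    F.invPropValue (dotProducts (Sum.elim k P))
      (fun a => shiftScales (scalesOf P m2) δ (Sum.inr a)) a = F.denom P m2 δ k a := by
  simp only [Family.invPropValue, Family.denom, shiftScales, scalesOf, Family.q, Sum.elim_inr,
    dotProducts, Sym2.lift_mk, mdot_sum_left, mdot_sum_right]
  push_cast
  simp only [Finset.mul_sum, mul_assoc]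
  rw [sub_right_comm]
  simp only [mdot_comm]

/-- The integrand after a shift of one exponent. -/
theorem Family.integrand_add (F : Family L n p) {d : ℕ} (P : Fin n → Fin d → ℝ) (m2 : Fin p → ℝ)
    {δ : ℝ} (hδ : 0 < δ) (k : Fin L → Fin d → ℝ) (ν : Fin p → ℤ) (a : Fin p) (m : ℤ) :
    F.integrand P m2 δ (ν + Pi.single a m) k =
      F.integrand P m2 δ ν k * F.denom P m2 δ k a ^ (-m) := by
  have : ∀ b, F.denom P m2 δ k b ^ (-(ν + Pi.single a m : Fin p → ℤ) b) =
      F.denom P m2 δ k b ^ (-ν b) * (if b = a then F.denom P m2 δ k b ^ (-m) else 1) := by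
    intro b
    rw [Pi.add_apply, neg_add, zpow_add₀ (F.denom_ne_zero P m2 hδ k b)]
    congr 1
    by_cases hb : b = a
    · subst hb; simp
    · simp [hb]
  change ∏ b, F.denom P m2 δ k b ^ (-(ν + Pi.single a m : Fin p → ℤ) b) =
    (∏ b, F.denom P m2 δ k b ^ (-ν b)) * _
  rw [Finset.prod_congr rfl fun b _ => this b, Finset.prod_mul_distrib]
  simp

/-- The derivative of a denominator with respect to the component `μ` of `k_i`. -/
theorem Family.hasDerivAt_denom (F : Family L n p) {d : ℕ} (P : Fin n → Fin d → ℝ)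
    (m2 : Fin p → ℝ) (δ : ℝ) (k : Fin L → Fin d → ℝ) (i : Fin L) (μ : Fin d) (a : Fin p) :
    HasDerivAt (fun s : ℝ =>
        F.denom P m2 δ (Function.update k i (Function.update (k i) μ s)) a)
      (-2 * (F.coeff a (Sum.inl i) : ℂ) *
        (((if (μ : ℕ) = 0 then 1 else -1) * F.q k P a μ : ℝ) : ℂ)) (k i μ) := by
  have hcomp : ∀ (t : Mom L n) (lam : Fin d), HasDerivAt (fun s : ℝ =>
      Sum.elim (Function.update k i (Function.update (k i) μ s)) P t lam)
      (if t = Sum.inl i ∧ lam = μ then 1 else 0) (k i μ) := by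
    rintro (j | j) lam
    · by_cases hj : j = i
      · subst hj
        by_cases hl : lam = μ
        · subst hl
          simpa using hasDerivAt_id' (k j lam)
        · simpa [hl] using hasDerivAt_const (k j μ) (k j lam)
      · simpa [hj] using hasDerivAt_const (k i μ) (k j lam)
    · simpa using hasDerivAt_const (k i μ) (P j lam)
  have hq : ∀ lam : Fin d, HasDerivAt (fun s : ℝ =>
      F.q (Function.update k i (Function.update (k i) μ s)) P a lam)
      (if lam = μ then (F.coeff a (Sum.inl i) : ℝ) else 0) (k i μ) := by
    intro lam
    have := HasDerivAt.fun_sum (u := Finset.univ) fun t _ =>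
      (hcomp t lam).const_mul (F.coeff a t : ℝ)
    convert! this using 1
    · funext s; simp only [Family.q, Finset.sum_apply, Pi.smul_apply, smul_eq_mul]
    · by_cases hl : lam = μ
      · subst hl
        rw [if_pos rfl, Finset.sum_eq_single (Sum.inl i)]
        · rw [if_pos ⟨rfl, rfl⟩, mul_one]
        · intro t _ ht
          rw [if_neg (fun h => ht h.1), mul_zero]
        · exact fun h => (h (Finset.mem_univ _)).elim
      · simp only [hl, and_false, if_false, mul_zero, Finset.sum_const_zero]
  have hm : HasDerivAt (fun s : ℝ =>
      mdot (F.q (Function.update k i (Function.update (k i) μ s)) P a)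
        (F.q (Function.update k i (Function.update (k i) μ s)) P a))
      (2 * (F.coeff a (Sum.inl i) : ℝ) * ((if (μ : ℕ) = 0 then 1 else -1) * F.q k P a μ))
      (k i μ) := by
    have := HasDerivAt.fun_sum (u := Finset.univ) fun lam _ =>
      ((hq lam).mul (hq lam)).const_mul (if (lam : ℕ) = 0 then (1 : ℝ) else -1)
    convert! this using 1
    rw [Finset.sum_eq_single μ]
    · rw [if_pos rfl, Function.update_eq_self, Function.update_eq_self]; ring
    · intro lam _ hl; simp [hl]
    · simp
  have := ((hm.const_sub (m2 a)).ofReal_comp).sub_const (Complex.I * δ)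
  convert! this using 1
  push_cast
  ring

theorem Family.hasDerivAt_integrand (F : Family L n p) {d : ℕ} (P : Fin n → Fin d → ℝ)
    (m2 : Fin p → ℝ) {δ : ℝ} (hδ : 0 < δ) (ν : Fin p → ℤ) (k : Fin L → Fin d → ℝ) (i : Fin L)
    (μ : Fin d) :
    HasDerivAt (fun s : ℝ =>
        F.integrand P m2 δ ν (Function.update k i (Function.update (k i) μ s)))
      (∑ a, 2 * (ν a : ℂ) * (F.coeff a (Sum.inl i) : ℂ) *
        (((if (μ : ℕ) = 0 then 1 else -1) * F.q k P a μ : ℝ) : ℂ) *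
          F.integrand P m2 δ (ν + Pi.single a 1) k) (k i μ) := by
  have hself : Function.update k i (Function.update (k i) μ (k i μ)) = k := by simp
  have h1 : ∀ a ∈ Finset.univ, HasDerivAt (fun s : ℝ =>
      F.denom P m2 δ (Function.update k i (Function.update (k i) μ s)) a ^ (-ν a))
      (((-ν a : ℤ) : ℂ) * F.denom P m2 δ k a ^ (-ν a - 1) * (-2 * (F.coeff a (Sum.inl i) : ℂ) *
        (((if (μ : ℕ) = 0 then 1 else -1) * F.q k P a μ : ℝ) : ℂ))) (k i μ) := by
    intro a _
    have hz := hasDerivAt_zpow (-ν a) (F.denom P m2 δ k a) (Or.inl (F.denom_ne_zero P m2 hδ k a))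
    have hd := F.hasDerivAt_denom P m2 δ k i μ a
    have hz' : HasDerivAt (fun z : ℂ => z ^ (-ν a)) (((-ν a : ℤ) : ℂ) *
        F.denom P m2 δ k a ^ (-ν a - 1))
        (F.denom P m2 δ (Function.update k i (Function.update (k i) μ (k i μ))) a) := by
      rw [hself]; exact hz
    exact hz'.comp (k i μ) hd
  have h2 := HasDerivAt.fun_finsetProd h1
  -- The two minus signs, from the exponent `-ν_a` and from `-q_a ^ 2`, cancel; the lost power of
  -- the denominator is the shift `ν + e_a`.
  refine h2.congr_deriv (Finset.sum_congr rfl fun a _ => ?_)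
  rw [F.integrand_add P m2 hδ k ν a 1, hself, smul_eq_mul]
  have h3 : F.integrand P m2 δ ν k = (∏ b ∈ Finset.univ.erase a,
      F.denom P m2 δ k b ^ (-ν b)) * F.denom P m2 δ k a ^ (-ν a) :=
    (Finset.prod_erase_mul _ (fun b => F.denom P m2 δ k b ^ (-ν b)) (Finset.mem_univ a)).symm
  rw [h3, zpow_sub₀ (F.denom_ne_zero P m2 hδ k a), zpow_neg_one, zpow_one]
  push_cast
  ring

/-- Product rule: the divergence of `v` counts the components, hence `d` when `v = k_i`. The metric
signs in the derivative of the denominators contract `v` and `q_a` to their Minkowski product, which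
is expanded in the momenta of `q_a`. -/
theorem Family.totalDerivative_integrand (F : Family L n p) {d : ℕ} (P : Fin n → Fin d → ℝ)
    (m2 : Fin p → ℝ) {δ : ℝ} (hδ : 0 < δ) (ν : Fin p → ℤ) (k : Fin L → Fin d → ℝ) (i : Fin L)
    (t : Mom L n) :
    totalDerivative P i t (F.integrand P m2 δ ν) k =
      (if t = Sum.inl i then (d : ℂ) * F.integrand P m2 δ ν k else 0) +
      ∑ a, ∑ u, 2 * (F.coeff a (Sum.inl i) : ℂ) * (F.coeff a u : ℂ) * (ν a : ℂ) *
        (dotProducts (Sum.elim k P) s(t, u) * F.integrand P m2 δ (ν + Pi.single a 1) k) := by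
  have hv : ∀ μ, HasDerivAt (fun s : ℝ =>
      ((Sum.elim (Function.update k i (Function.update (k i) μ s)) P t μ : ℝ) : ℂ))
      (if t = Sum.inl i then 1 else 0) (k i μ) := by
    intro μ
    rcases t with j | j
    · by_cases hj : j = i
      · subst hj
        simpa using (hasDerivAt_id (k j μ)).ofReal_comp
      · simpa [hj] using hasDerivAt_const (k i μ) ((k j μ : ℝ) : ℂ)
    · simpa using hasDerivAt_const (k i μ) ((P j μ : ℝ) : ℂ)
  have hself : ∀ μ, Function.update k i (Function.update (k i) μ (k i μ)) = k := by simp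
  have h1 : ∀ μ, deriv (fun s : ℝ =>
      ((Sum.elim (Function.update k i (Function.update (k i) μ s)) P t μ : ℝ) : ℂ) *
        F.integrand P m2 δ ν (Function.update k i (Function.update (k i) μ s))) (k i μ) =
      (if t = Sum.inl i then 1 else 0) * F.integrand P m2 δ ν k +
      ((Sum.elim k P t μ : ℝ) : ℂ) * (∑ a, 2 * (ν a : ℂ) * (F.coeff a (Sum.inl i) : ℂ) *
        (((if (μ : ℕ) = 0 then 1 else -1) * F.q k P a μ : ℝ) : ℂ) *
          F.integrand P m2 δ (ν + Pi.single a 1) k) := by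
    intro μ
    rw [((hv μ).fun_mul (F.hasDerivAt_integrand P m2 hδ ν k i μ)).deriv, hself]
  rw [totalDerivative, Finset.sum_congr rfl fun μ _ => h1 μ, Finset.sum_add_distrib]
  congr 1
  · split_ifs <;> simp
  · simp only [Finset.mul_sum]
    rw [Finset.sum_comm]
    refine Finset.sum_congr rfl fun a _ => ?_
    have hq : ∑ u, (F.coeff a u : ℂ) * dotProducts (Sum.elim k P) s(t, u) =
        ∑ μ, ((Sum.elim k P t μ : ℝ) : ℂ) *
          (((if (μ : ℕ) = 0 then 1 else -1) * F.q k P a μ : ℝ) : ℂ) := by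
      have h2 : mdot (Sum.elim k P t) (F.q k P a) =
          ∑ u, (F.coeff a u : ℝ) * mdot (Sum.elim k P t) (Sum.elim k P u) := by
        rw [Family.q, mdot_sum_right]
      have h3 := congrArg (fun z : ℝ => (z : ℂ)) h2
      simp only [dotProducts, Sym2.lift_mk]
      push_cast at h3
      rw [← h3, mdot]
      push_cast
      exact Finset.sum_congr rfl fun μ _ => by ring
    calc _ = (2 * (ν a : ℂ) * (F.coeff a (Sum.inl i) : ℂ) *
          F.integrand P m2 δ (ν + Pi.single a 1) k) * ∑ μ, ((Sum.elim k P t μ : ℝ) : ℂ) *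
          (((if (μ : ℕ) = 0 then 1 else -1) * F.q k P a μ : ℝ) : ℂ) := by
          rw [Finset.mul_sum]; exact Finset.sum_congr rfl fun μ _ => by ring
      _ = _ := by
          rw [← hq, Finset.mul_sum]; exact Finset.sum_congr rfl fun μ _ => by ring

theorem Family.Reduces.totalDerivative_eq {F : Family L n p} {l r} (h : F.Reduces l r) (D₀ : ℕ)
    (i : Fin L) (t : Mom L n) {d : ℕ} (P : Fin n → Fin d → ℝ) (m2 : Fin p → ℝ) {δ : ℝ}
    (hδ : 0 < δ) (ν : Fin p → ℤ) (k : Fin L → Fin d → ℝ) :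
    totalDerivative P i t (F.integrand P m2 δ ν) k =
      (F.ibpCoeff l r D₀ i t).sum fun s b =>
        Coeff.eval b (shiftScales (scalesOf P m2) δ) ν (((D₀ : ℂ) - d) / 2) *
          F.integrand P m2 δ (ν + s) k := by
  rw [F.sum_ibpCoeff l r D₀ i t _ ν _ (fun s => F.integrand P m2 δ (ν + s) k),
    F.totalDerivative_integrand P m2 hδ]
  congr 1
  · rw [add_zero]
    congr 2
    ring
  · refine Finset.sum_congr rfl fun a _ => Finset.sum_congr rfl fun u _ => ?_
    congr 1
    rw [h.eval (dotProducts (Sum.elim k P)) (shiftScales (scalesOf P m2) δ) (by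
      intro e
      induction e using Sym2.ind with
      | _ a b => simp [dotProducts, shiftScales, scalesOf]) t u, add_mul, Finset.sum_mul]
    congr 1
    refine Finset.sum_congr rfl fun b _ => ?_
    have : ν + (Pi.single a 1 - Pi.single b 1) = ν + Pi.single a 1 + Pi.single b (-1) := by
      rw [Pi.single_neg]; abel
    rw [this, F.integrand_add P m2 hδ k (ν + Pi.single a 1) b (-1), F.invPropValue_dotProducts,
      neg_neg, zpow_one]
    ring

/-! ### Polynomials in the Schwinger parameters -/

/-- The value of a polynomial at real Schwinger parameters. -/
def ev (α : Fin p → ℝ) : MvPolynomial (Fin p) ℂ →+* ℂ :=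
  MvPolynomial.eval fun a => (α a : ℂ)

@[simp] theorem ev_X (α : Fin p → ℝ) (a : Fin p) : ev α (MvPolynomial.X a) = α a := by simp [ev]

@[simp] theorem ev_C (α : Fin p → ℝ) (c : ℂ) : ev α (MvPolynomial.C c) = c := by simp [ev]

/-- The commutator of two derivations is a derivation, and this one kills the variables. -/
theorem pderiv_pderiv_comm {σ K : Type*} [CommRing K] (a b : σ) (P : MvPolynomial σ K) :
    MvPolynomial.pderiv a (MvPolynomial.pderiv b P) =
      MvPolynomial.pderiv b (MvPolynomial.pderiv a P) := by
  have h : ⁅(MvPolynomial.pderiv a : Derivation K (MvPolynomial σ K) (MvPolynomial σ K)),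
      (MvPolynomial.pderiv b : Derivation K (MvPolynomial σ K) (MvPolynomial σ K))⁆ = 0 := by
    apply MvPolynomial.derivation_ext
    intro i
    classical
    rw [Derivation.commutator_apply]
    simp only [MvPolynomial.pderiv_X, Derivation.coe_zero, Pi.zero_apply]
    by_cases h1 : i = a <;> by_cases h2 : i = b <;> simp [Pi.single_apply, h1, h2] <;>
      split_ifs <;> simp
  have h2 := congrArg (fun D => D P) h
  simpa [Derivation.commutator_apply, sub_eq_zero] using h2

theorem hasDerivAt_ev (P : MvPolynomial (Fin p) ℂ) (a : Fin p) (α : Fin p → ℝ) (s : ℝ) :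
    HasDerivAt (fun s : ℝ => ev (Function.update α a s) P)
      (ev (Function.update α a s) (MvPolynomial.pderiv a P)) s := by
  induction P using MvPolynomial.induction_on with
  | C c => simpa using hasDerivAt_const s c
  | add P Q hP hQ => simpa using hP.fun_add hQ
  | mul_X P b hP =>
    have hb : HasDerivAt (fun s : ℝ => ((Function.update α a s b : ℝ) : ℂ))
        (ev (Function.update α a s) (MvPolynomial.pderiv a (MvPolynomial.X b))) s := by
      by_cases h : b = a
      · subst h
        simpa using (hasDerivAt_id s).ofReal_comp
      · simpa [h, MvPolynomial.pderiv_X_of_ne h] using hasDerivAt_const s ((α b : ℝ) : ℂ)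
    have := hP.fun_mul hb
    simp only [map_mul, ev_X]
    refine this.congr_deriv ?_
    rw [MvPolynomial.pderiv_mul, map_add, map_mul, map_mul, ev_X]

theorem continuous_ev (P : MvPolynomial (Fin p) ℂ) : Continuous fun α : Fin p → ℝ => ev α P := by
  have : Continuous fun α : Fin p → ℝ => fun a => (α a : ℂ) := by fun_prop
  exact (MvPolynomial.continuous_eval P).comp this

theorem one_le_prod_of_one_le {ι : Type*} {s : Finset ι} {f : ι → ℝ} (hf : ∀ a ∈ s, 1 ≤ f a) :
    1 ≤ ∏ a ∈ s, f a :=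
  Finset.prod_induction _ (1 ≤ ·) (fun _ _ ha hb => one_le_mul_of_one_le_of_one_le ha hb) le_rfl hf

/-- The bound is a product over the parameters so that integrability for a product measure reduces
to one variable. `1 ≤ C` allows the bound to be raised to larger powers. -/
theorem exists_norm_ev_le (P : MvPolynomial (Fin p) ℂ) :
    ∃ (C : ℝ) (k : ℕ), 1 ≤ C ∧ ∀ α : Fin p → ℝ, ‖ev α P‖ ≤ C * ∏ a, (1 + |α a|) ^ k := by
  have hone : ∀ (α : Fin p → ℝ) (k : ℕ), 1 ≤ ∏ a, (1 + |α a|) ^ k := fun α k =>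
    one_le_prod_of_one_le fun a _ => one_le_pow₀ (by linarith [abs_nonneg (α a)])
  have hmono : ∀ (α : Fin p → ℝ) {k m : ℕ}, k ≤ m →
      ∏ a, (1 + |α a|) ^ k ≤ ∏ a, (1 + |α a|) ^ m := fun α k m hkm =>
    Finset.prod_le_prod (fun a _ => by positivity) fun a _ =>
      pow_le_pow_right₀ (by linarith [abs_nonneg (α a)]) hkm
  induction P using MvPolynomial.induction_on with
  | C c =>
    refine ⟨1 + ‖c‖, 0, by linarith [norm_nonneg c], fun α => ?_⟩
    simp
  | add P Q hP hQ =>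
    obtain ⟨C, k, hC, h⟩ := hP
    obtain ⟨C', k', hC', h'⟩ := hQ
    refine ⟨C + C', max k k', by linarith, fun α => ?_⟩
    rw [map_add, add_mul]
    refine (norm_add_le _ _).trans (add_le_add ((h α).trans ?_) ((h' α).trans ?_))
    · exact mul_le_mul_of_nonneg_left (hmono α (le_max_left _ _)) (by linarith)
    · exact mul_le_mul_of_nonneg_left (hmono α (le_max_right _ _)) (by linarith)
  | mul_X P b hP =>
    obtain ⟨C, k, hC, h⟩ := hP
    refine ⟨C, k + 1, hC, fun α => ?_⟩
    rw [map_mul, ev_X, norm_mul, Complex.norm_real, Real.norm_eq_abs]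
    simp only [pow_succ]
    rw [Finset.prod_mul_distrib, ← mul_assoc]
    refine mul_le_mul (h α) ?_ (abs_nonneg _) (by positivity)
    have := Finset.mul_prod_erase Finset.univ (fun a => 1 + |α a|) (Finset.mem_univ b)
    rw [← this]
    have h1 : 1 ≤ ∏ a ∈ Finset.univ.erase b, (1 + |α a|) :=
      one_le_prod_of_one_le fun a _ => by linarith [abs_nonneg (α a)]
    nlinarith [abs_nonneg (α b)]

/-! ### Functions of Gaussian type -/

/-- The function `P * U ^ z * exp (-i V / U)`, continued by zero to the points with `U ≤ 0`. -/
def expFun (U V : MvPolynomial (Fin p) ℂ) (z : ℂ) (P : MvPolynomial (Fin p) ℂ) (α : Fin p → ℝ) :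
    ℂ :=
  if 0 < (ev α U).re then
    ev α P * (ev α U ^ z * Complex.exp (-Complex.I * ev α V / ev α U)) else 0

/-- The assumptions on `U` and `V`: `U` is real, and `V / U` has the imaginary part
`-δ ∑ a, α a`. -/
structure IsDamped (U V : MvPolynomial (Fin p) ℂ) (δ : ℝ) : Prop where
  im_eq : ∀ α, (ev α U).im = 0
  norm_exp : ∀ α, 0 < (ev α U).re →
    ‖Complex.exp (-Complex.I * ev α V / ev α U)‖ = Real.exp (-δ * ∑ a, α a)

variable {U V : MvPolynomial (Fin p) ℂ} {δ : ℝ}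

theorem IsDamped.ofReal_re (h : IsDamped U V δ) (α : Fin p → ℝ) :
    (((ev α U).re : ℝ) : ℂ) = ev α U := by
  apply Complex.ext <;> simp [h.im_eq]

theorem IsDamped.norm_expFun_le (h : IsDamped U V δ) (z : ℂ)
    (P : MvPolynomial (Fin p) ℂ) (α : Fin p → ℝ) :
    ‖expFun U V z P α‖ ≤ ‖ev α P‖ * (|(ev α U).re| ^ z.re * Real.exp (-δ * ∑ a, α a)) := by
  unfold expFun
  split_ifs with hu
  · rw [norm_mul, norm_mul, h.norm_exp α hu, abs_of_pos hu]
    nth_rewrite 1 [← h.ofReal_re α]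
    rw [Complex.norm_cpow_eq_rpow_re_of_pos hu]
  · rw [norm_zero]
    positivity

theorem measurable_expFun (U V : MvPolynomial (Fin p) ℂ) (z : ℂ) (P : MvPolynomial (Fin p) ℂ) :
    Measurable (expFun U V z P) := by
  have hU := (continuous_ev U).measurable
  have hV := (continuous_ev V).measurable
  have hP := (continuous_ev P).measurable
  refine Measurable.ite ?_ ?_ measurable_const
  · exact measurableSet_lt measurable_const (Complex.measurable_re.comp hU)
  · fun_prop

theorem IsDamped.exists_bound (h : IsDamped U V δ) {z : ℂ} (hz : 0 < z.re)
    (P : MvPolynomial (Fin p) ℂ) : ∃ (C : ℝ) (k : ℕ), ∀ α : Fin p → ℝ,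
      ‖expFun U V z P α‖ ≤ C * ∏ a, ((1 + |α a|) ^ k * Real.exp (-δ * α a)) := by
  obtain ⟨C, k, hC, hP⟩ := exists_norm_ev_le P
  obtain ⟨C', k', hC', hU⟩ := exists_norm_ev_le U
  -- A natural exponent keeps the bound a product of integer powers; enlarging the exponent is
  -- harmless because the base is at least `1`.
  obtain ⟨N, hN⟩ := exists_nat_ge z.re
  refine ⟨C * C' ^ N, k + k' * N, fun α => (h.norm_expFun_le z P α).trans ?_⟩
  have hone : 1 ≤ C' * ∏ a, (1 + |α a|) ^ k' := by
    have : 1 ≤ ∏ a, (1 + |α a|) ^ k' :=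
      one_le_prod_of_one_le fun a _ => one_le_pow₀ (by linarith [abs_nonneg (α a)])
    nlinarith
  have h1 : |(ev α U).re| ^ z.re ≤ (C' * ∏ a, (1 + |α a|) ^ k') ^ N := by
    rw [← Real.rpow_natCast]
    refine (Real.rpow_le_rpow (abs_nonneg _) ((Complex.abs_re_le_norm _).trans (hU α)) hz.le).trans
      (Real.rpow_le_rpow_of_exponent_le hone hN)
  have h2 : Real.exp (-δ * ∑ a, α a) = ∏ a, Real.exp (-δ * α a) := by
    rw [← Real.exp_sum, Finset.mul_sum]
  calc _ ≤ (C * ∏ a, (1 + |α a|) ^ k) *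
        ((C' * ∏ a, (1 + |α a|) ^ k') ^ N * ∏ a, Real.exp (-δ * α a)) := by
        rw [h2]
        have := hP α
        gcongr
    _ = _ := by
        rw [mul_pow, ← Finset.prod_pow, Finset.prod_mul_distrib]
        simp only [pow_add, pow_mul]
        rw [Finset.prod_mul_distrib]
        ring

/-- The polynomial that represents the image of `expFun U V z P` under `insertProp a`. -/
def insOp (U V : MvPolynomial (Fin p) ℂ) (a : Fin p) (z : ℂ) :
    MvPolynomial (Fin p) ℂ →ₗ[ℂ] MvPolynomial (Fin p) ℂ :=
  LinearMap.mulLeft ℂ (MvPolynomial.C Complex.I * U ^ 2) ∘ₗ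
    (MvPolynomial.pderiv a).toLinearMap +
  LinearMap.mulLeft ℂ (MvPolynomial.C (Complex.I * z) * (U * MvPolynomial.pderiv a U) +
    (U * MvPolynomial.pderiv a V - V * MvPolynomial.pderiv a U))

theorem insOp_apply (a : Fin p) (z : ℂ) (P : MvPolynomial (Fin p) ℂ) :
    insOp U V a z P = MvPolynomial.C Complex.I * U ^ 2 * MvPolynomial.pderiv a P +
      (MvPolynomial.C (Complex.I * z) * (U * MvPolynomial.pderiv a U) +
        (U * MvPolynomial.pderiv a V - V * MvPolynomial.pderiv a U)) * P := rfl

/-- Symmetry of second derivatives on the level of polynomials, which avoids any smoothness argument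
at the zeros of `U`. -/
theorem insOp_comm (a b : Fin p) (z : ℂ) (P : MvPolynomial (Fin p) ℂ) :
    insOp U V b (z - 2) (insOp U V a z P) = insOp U V a (z - 2) (insOp U V b z P) := by
  have h2 : (MvPolynomial.C (2 : ℂ) : MvPolynomial (Fin p) ℂ) = 2 := map_ofNat _ 2
  simp only [insOp_apply, map_add, map_sub, MvPolynomial.pderiv_mul, MvPolynomial.pderiv_C,
    MvPolynomial.pderiv_pow, MvPolynomial.C_mul, mul_sub, h2, pderiv_pderiv_comm b a]
  ring

/-- Where `U > 0` this is the quotient and chain rule, with `U ^ (z - 2)` as common factor. Where `U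
< 0` the function vanishes locally. At `U = 0` the function is `O(|U| ^ Re z)` and `U` is `O(s' -
s)`, so `Re z > 1` makes the derivative zero. Numerator insertions are evaluated at points with some
`α_a = 0`, where `U` may vanish, so this last case is needed. -/
theorem IsDamped.hasDerivAt_expFun (h : IsDamped U V δ) {z : ℂ} (hz : 1 < z.re)
    (P : MvPolynomial (Fin p) ℂ) (a : Fin p) (α : Fin p → ℝ) (s : ℝ) :
    HasDerivAt (fun s : ℝ => expFun U V z P (Function.update α a s))
      (-Complex.I * expFun U V (z - 2) (insOp U V a z P) (Function.update α a s)) s := by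
  have hU := hasDerivAt_ev U a α s
  have hV := hasDerivAt_ev V a α s
  have hP := hasDerivAt_ev P a α s
  have hre : HasDerivAt (fun s : ℝ => (ev (Function.update α a s) U).re)
      (ev (Function.update α a s) (MvPolynomial.pderiv a U)).re s :=
    Complex.reCLM.hasFDerivAt.comp_hasDerivAt s hU
  rcases lt_trichotomy 0 (ev (Function.update α a s) U).re with hu | hu | hu
  · have hev : ∀ᶠ s' in 𝓝 s, 0 < (ev (Function.update α a s') U).re :=
      hre.continuousAt.eventually (lt_mem_nhds hu)
    have hne : ev (Function.update α a s) U ≠ 0 := fun h0 => by simp [h0] at hu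
    have hslit : ev (Function.update α a s) U ∈ Complex.slitPlane := Or.inl hu
    have hpow := (Complex.hasStrictDerivAt_cpow_const (c := z) hslit).hasDerivAt.comp s hU
    have hexp := ((hV.const_mul (-Complex.I)).fun_div hU hne).cexp
    have hall := hP.fun_mul (hpow.fun_mul hexp)
    refine (hall.congr_of_eventuallyEq ?_).congr_deriv ?_
    · filter_upwards [hev] with s' hs'
      simp [expFun, hs']
    · simp only [expFun, if_pos hu, insOp_apply, map_add, map_mul, map_sub, map_pow, ev_C,
        Function.comp_apply]
      rw [Complex.cpow_sub _ _ hne, Complex.cpow_sub _ _ hne, Complex.cpow_one,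
        show ev (Function.update α a s) U ^ (2 : ℂ) = ev (Function.update α a s) U ^ 2 by
          exact_mod_cast Complex.cpow_natCast _ 2]
      field_simp
      ring_nf
      simp only [Complex.I_sq]
      ring
  · have h0 : expFun U V (z - 2) (insOp U V a z P) (Function.update α a s) = 0 := by
      simp [expFun, ← hu]
    rw [h0, mul_zero, hasDerivAt_iff_isLittleO]
    have h0' : expFun U V z P (Function.update α a s) = 0 := by
      simp [expFun, ← hu]
    simp only [h0', sub_zero, smul_zero]
    have hbig : (fun s' => (ev (Function.update α a s') U).re) =O[𝓝 s] fun s' => s' - s := by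
      have := hre.isBigO_sub
      simpa [← hu] using this
    have hcont : Continuous fun s' : ℝ => Function.update α a s' :=
      continuous_const.update a continuous_id
    have hK : (fun s' : ℝ => ‖ev (Function.update α a s') P‖ *
        Real.exp (-δ * ∑ b, Function.update α a s' b)) =O[𝓝 s] fun _ => (1 : ℝ) := by
      refine Filter.Tendsto.isBigO_one ℝ (Continuous.tendsto ?_ s)
      have h1 := (continuous_ev P).comp hcont
      have h2 : Continuous fun s' => ∑ b, Function.update α a s' b :=
        continuous_finsetSum _ fun b _ => (continuous_apply b).comp hcont
      exact (h1.norm).mul (Real.continuous_exp.comp (continuous_const.mul h2))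
    have hsmall : (fun s' : ℝ => |(ev (Function.update α a s') U).re| ^ (z.re - 1)) =o[𝓝 s]
        fun _ => (1 : ℝ) := by
      rw [Asymptotics.isLittleO_one_iff]
      have h1 : ContinuousAt (fun s' : ℝ => |(ev (Function.update α a s') U).re| ^ (z.re - 1)) s :=
        (hre.continuousAt.abs).rpow_const (Or.inr (by linarith))
      have h2 := h1.tendsto
      rwa [← hu, abs_zero, Real.zero_rpow (by linarith)] at h2
    -- Splitting `|U| ^ Re z = |U| ^ (Re z - 1) * |U|` gives bounded times `o(1)` times `O(s' - s)`.
    have hprod := (hK.mul_isLittleO hsmall).mul_isBigO hbig.abs_left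
    simp only [one_mul, mul_one] at hprod
    refine Asymptotics.IsBigO.trans_isLittleO ?_ hprod
    refine Asymptotics.IsBigO.of_bound 1 (Filter.Eventually.of_forall fun s' => ?_)
    refine (h.norm_expFun_le z P _).trans (le_of_eq ?_)
    rw [one_mul, Real.norm_of_nonneg (by positivity)]
    have : |(ev (Function.update α a s') U).re| ^ z.re =
        |(ev (Function.update α a s') U).re| ^ (z.re - 1) * |(ev (Function.update α a s') U).re| := by
      rcases (abs_nonneg (ev (Function.update α a s') U).re).eq_or_lt with h0 | h0
      · rw [← h0, mul_zero, Real.zero_rpow (by linarith)]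
      · rw [Real.rpow_sub_one h0.ne', div_mul_cancel₀ _ h0.ne']
    rw [this]
    ring
  · have hev : ∀ᶠ s' in 𝓝 s, (ev (Function.update α a s') U).re < 0 :=
      hre.continuousAt.eventually (gt_mem_nhds hu)
    have h0 : expFun U V (z - 2) (insOp U V a z P) (Function.update α a s) = 0 := by
      simp [expFun, hu.le]
    rw [h0, mul_zero]
    refine (hasDerivAt_const s (0 : ℂ)).congr_of_eventuallyEq ?_
    filter_upwards [hev] with s' hs'
    simp [expFun, hs'.le]

theorem IsDamped.insertProp_expFun (h : IsDamped U V δ) {z : ℂ} (hz : 1 < z.re)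
    (P : MvPolynomial (Fin p) ℂ) (a : Fin p) :
    insertProp a (expFun U V z P) = expFun U V (z - 2) (insOp U V a z P) := by
  funext α
  rw [insertProp, (h.hasDerivAt_expFun hz P a α (α a)).deriv, Function.update_eq_self, ← mul_assoc]
  simp

/-- Functions of Gaussian type that can be differentiated `N` times. -/
def Nice (U V : MvPolynomial (Fin p) ℂ) (N : ℕ) (f : (Fin p → ℝ) → ℂ) : Prop :=
  ∃ (z : ℂ) (P : MvPolynomial (Fin p) ℂ), 2 * (N : ℝ) < z.re ∧ f = expFun U V z P

theorem Nice.mono {N M : ℕ} {f : (Fin p → ℝ) → ℂ} (hf : Nice U V N f) (hM : M ≤ N) :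
    Nice U V M f := by
  obtain ⟨z, P, hz, rfl⟩ := hf
  have : (M : ℝ) ≤ N := by exact_mod_cast hM
  exact ⟨z, P, by linarith, rfl⟩

theorem Nice.measurable {N : ℕ} {f : (Fin p → ℝ) → ℂ} (hf : Nice U V N f) : Measurable f := by
  obtain ⟨z, P, hz, rfl⟩ := hf
  exact measurable_expFun U V z P

theorem Nice.exists_bound (h : IsDamped U V δ) {N : ℕ} {f : (Fin p → ℝ) → ℂ} (hf : Nice U V N f) :
    ∃ (C : ℝ) (k : ℕ), ∀ α : Fin p → ℝ,
      ‖f α‖ ≤ C * ∏ a, ((1 + |α a|) ^ k * Real.exp (-δ * α a)) := by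
  obtain ⟨z, P, hz, rfl⟩ := hf
  have : (0 : ℝ) ≤ N := N.cast_nonneg
  exact h.exists_bound (by linarith) P

theorem Nice.insertProp (h : IsDamped U V δ) {N : ℕ} {f : (Fin p → ℝ) → ℂ}
    (hf : Nice U V (N + 1) f) (a : Fin p) : Nice U V N (insertProp a f) := by
  obtain ⟨z, P, hz, rfl⟩ := hf
  have : (0 : ℝ) ≤ N := N.cast_nonneg
  push_cast at hz
  refine ⟨z - 2, insOp U V a z P, ?_, h.insertProp_expFun (by linarith) P a⟩
  simp only [Complex.sub_re, Complex.re_ofNat]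
  linarith

theorem Nice.hasDerivAt (h : IsDamped U V δ) {N : ℕ} {f : (Fin p → ℝ) → ℂ}
    (hf : Nice U V (N + 1) f) (a : Fin p) (α : Fin p → ℝ) (s : ℝ) :
    HasDerivAt (fun s : ℝ => f (Function.update α a s))
      (-Complex.I * Feynman.insertProp a f (Function.update α a s)) s := by
  obtain ⟨z, P, hz, rfl⟩ := hf
  have : (0 : ℝ) ≤ N := N.cast_nonneg
  push_cast at hz
  rw [h.insertProp_expFun (by linarith)]
  exact h.hasDerivAt_expFun (by linarith) P a α s

theorem Nice.insertProp_comm (h : IsDamped U V δ) {N : ℕ} {f : (Fin p → ℝ) → ℂ}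
    (hf : Nice U V (N + 2) f) (a b : Fin p) :
    Feynman.insertProp a (Feynman.insertProp b f) =
      Feynman.insertProp b (Feynman.insertProp a f) := by
  obtain ⟨z, P, hz, rfl⟩ := hf
  have : (0 : ℝ) ≤ N := N.cast_nonneg
  push_cast at hz
  have hz' : 1 < (z - 2).re := by
    simp only [Complex.sub_re, Complex.re_ofNat]
    linarith
  rw [h.insertProp_expFun (by linarith) P a, h.insertProp_expFun (by linarith) P b,
    h.insertProp_expFun hz', h.insertProp_expFun hz', insOp_comm]

/-- Multiplication with a Schwinger parameter. -/
def mulParam (a : Fin p) (f : (Fin p → ℝ) → ℂ) : (Fin p → ℝ) → ℂ := fun α => (α a : ℂ) * f α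

theorem mulParam_expFun (a : Fin p) (z : ℂ) (P : MvPolynomial (Fin p) ℂ) :
    mulParam a (expFun U V z P) = expFun U V z (MvPolynomial.X a * P) := by
  funext α
  unfold mulParam expFun
  split_ifs
  · rw [map_mul, ev_X]; ring
  · simp

theorem Nice.mulParam {N : ℕ} {f : (Fin p → ℝ) → ℂ} (hf : Nice U V N f) (a : Fin p) :
    Nice U V N (mulParam a f) := by
  obtain ⟨z, P, hz, rfl⟩ := hf
  exact ⟨z, _, hz, mulParam_expFun a z P⟩

theorem insertProp_mulParam_of_ne {a b : Fin p} (hab : b ≠ a) (f : (Fin p → ℝ) → ℂ) :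
    insertProp b (mulParam a f) = mulParam a (insertProp b f) := by
  funext α
  simp only [insertProp, mulParam, Function.update_of_ne hab.symm, deriv_const_mul_field]
  ring

/-! ### Iterated insertions -/

/-- Insertion of `m a` copies of the inverse propagator `a`, for all `a` in a list. -/
def insertList (m : Fin p → ℕ) (l : List (Fin p)) (f : (Fin p → ℝ) → ℂ) : (Fin p → ℝ) → ℂ :=
  l.foldr (fun a g => (insertProp a)^[m a] g) f

theorem IsDamped.exists_iterate (h : IsDamped U V δ) (a : Fin p) (k : ℕ) :
    ∀ z : ℂ, 2 * (k : ℝ) < z.re →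
    ∃ T : MvPolynomial (Fin p) ℂ →ₗ[ℂ] MvPolynomial (Fin p) ℂ, ∀ P,
      (insertProp a)^[k] (expFun U V z P) = expFun U V (z - 2 * k) (T P) := by
  induction k with
  | zero => exact fun z _ => ⟨LinearMap.id, fun P => by simp⟩
  | succ k ih =>
    intro z hz
    have : (0 : ℝ) ≤ k := k.cast_nonneg
    push_cast at hz
    obtain ⟨T, hT⟩ := ih (z - 2) (by
      simp only [Complex.sub_re, Complex.re_ofNat]; linarith)
    refine ⟨T ∘ₗ insOp U V a z, fun P => ?_⟩
    rw [Function.iterate_succ_apply, h.insertProp_expFun (by linarith), hT, LinearMap.comp_apply]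
    congr 1
    push_cast
    ring

/-- The point is that one linear `T` serves all `P`: iterated derivatives become additive without
separate differentiability arguments. -/
theorem IsDamped.exists_insertList (h : IsDamped U V δ) (m : Fin p → ℕ) (l : List (Fin p)) :
    ∀ z : ℂ, 2 * (((l.map m).sum : ℕ) : ℝ) < z.re →
    ∃ T : MvPolynomial (Fin p) ℂ →ₗ[ℂ] MvPolynomial (Fin p) ℂ, ∀ P,
      insertList m l (expFun U V z P) = expFun U V (z - 2 * ((l.map m).sum : ℕ)) (T P) := by
  induction l with
  | nil => exact fun z _ => ⟨LinearMap.id, fun P => by simp [insertList]⟩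
  | cons a l ih =>
    intro z hz
    rw [List.map_cons, List.sum_cons] at hz ⊢
    rw [Nat.cast_add] at hz ⊢
    have h0 : (0 : ℝ) ≤ m a := (m a).cast_nonneg
    obtain ⟨T, hT⟩ := ih z (by linarith)
    obtain ⟨T', hT'⟩ := h.exists_iterate a (m a) (z - 2 * ((l.map m).sum : ℕ)) (by
      have : (z - 2 * (((l.map m).sum : ℕ) : ℂ)).re = z.re - 2 * (((l.map m).sum : ℕ) : ℝ) := by
        rw [Complex.sub_re, ← Complex.ofReal_natCast, ← Complex.ofReal_ofNat, ← Complex.ofReal_mul,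
          Complex.ofReal_re]
      rw [this]; linarith)
    refine ⟨T' ∘ₗ T, fun P => ?_⟩
    have := hT P
    simp only [insertList] at this
    simp only [insertList, List.foldr_cons, this, hT', LinearMap.comp_apply]
    congr 1
    ring

theorem Nice.iterate (h : IsDamped U V δ) {N k : ℕ} {f : (Fin p → ℝ) → ℂ}
    (hf : Nice U V (N + k) f) (a : Fin p) : Nice U V N ((Feynman.insertProp a)^[k] f) := by
  induction k generalizing f with
  | zero => exact hf
  | succ k ih =>
    rw [Function.iterate_succ_apply]
    exact ih (hf.insertProp h a)

theorem Nice.insertList (h : IsDamped U V δ) {m : Fin p → ℕ} {l : List (Fin p)} {N : ℕ}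
    {f : (Fin p → ℝ) → ℂ} (hf : Nice U V (N + (l.map m).sum) f) :
    Nice U V N (insertList m l f) := by
  induction l generalizing N with
  | nil => exact hf
  | cons a l ih =>
    rw [List.map_cons, List.sum_cons, ← add_assoc] at hf
    exact (ih hf).iterate h a

theorem Nice.iterate_comm (h : IsDamped U V δ) {k : ℕ} {f : (Fin p → ℝ) → ℂ} (a b : Fin p)
    (hf : Nice U V (2 + k) f) :
    (Feynman.insertProp b)^[k] (Feynman.insertProp a f) =
      Feynman.insertProp a ((Feynman.insertProp b)^[k] f) := by
  induction k with
  | zero => rfl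
  | succ k ih =>
    rw [Function.iterate_succ_apply', Function.iterate_succ_apply', ih (hf.mono (by omega)),
      ((hf.mono (by omega)).iterate h b : Nice U V (0 + 2) _).insertProp_comm h]

theorem Nice.insertList_comm (h : IsDamped U V δ) {m : Fin p → ℕ} {l : List (Fin p)}
    {f : (Fin p → ℝ) → ℂ} (a : Fin p) (hf : Nice U V (2 + (l.map m).sum) f) :
    Feynman.insertList m l (Feynman.insertProp a f) =
      Feynman.insertProp a (Feynman.insertList m l f) := by
  induction l with
  | nil => rfl
  | cons b l ih =>
    rw [List.map_cons, List.sum_cons] at hf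
    change (Feynman.insertProp b)^[m b] (Feynman.insertList m l (Feynman.insertProp a f)) = _
    rw [ih (hf.mono (by omega))]
    refine Nice.iterate_comm h a b ?_
    exact Nice.insertList h (hf.mono (by omega))

theorem insertList_congr {m m' : Fin p → ℕ} {l : List (Fin p)} (hm : ∀ a ∈ l, m a = m' a)
    (f : (Fin p → ℝ) → ℂ) : insertList m l f = insertList m' l f := by
  induction l with
  | nil => rfl
  | cons b l ih =>
    change (insertProp b)^[m b] (insertList m l f) = (insertProp b)^[m' b] (insertList m' l f)
    rw [ih fun a ha => hm a (List.mem_cons_of_mem _ ha), hm b List.mem_cons_self]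

/-- The extra insertion sits at the place of `a` in the list and is commuted outwards past the
earlier entries; `Nodup` ensures that it occurs only once. -/
theorem Nice.insertList_succ (h : IsDamped U V δ) {m m' : Fin p → ℕ} {l : List (Fin p)}
    (hl : l.Nodup) {a : Fin p} (ha : a ∈ l) (hm : m' a = m a + 1) (hm' : ∀ b ≠ a, m' b = m b)
    {f : (Fin p → ℝ) → ℂ} (hf : Nice U V (2 + (l.map m).sum) f) :
    Feynman.insertList m' l f = Feynman.insertProp a (Feynman.insertList m l f) := by
  induction l with
  | nil => simp at ha
  | cons b l ih =>
    rw [List.map_cons, List.sum_cons] at hf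
    rw [List.nodup_cons] at hl
    change (Feynman.insertProp b)^[m' b] (Feynman.insertList m' l f) =
      Feynman.insertProp a ((Feynman.insertProp b)^[m b] (Feynman.insertList m l f))
    by_cases hb : b = a
    · subst hb
      rw [insertList_congr (m' := m) fun c hc => hm' c fun h0 => hl.1 (h0 ▸ hc), hm,
        Function.iterate_succ_apply']
    · have ha' : a ∈ l := by
        rcases List.mem_cons.1 ha with h1 | h1
        · exact absurd h1.symm hb
        · exact h1
      rw [ih hl.2 ha' (hf.mono (by omega)), hm' b hb]
      exact Nice.iterate_comm h a b (Nice.insertList h (hf.mono (by omega)))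

theorem insertList_mulParam {m : Fin p → ℕ} {a : Fin p} (hm : m a = 0) (l : List (Fin p))
    (f : (Fin p → ℝ) → ℂ) : insertList m l (mulParam a f) = mulParam a (insertList m l f) := by
  induction l with
  | nil => rfl
  | cons b l ih =>
    change (insertProp b)^[m b] (insertList m l (mulParam a f)) =
      mulParam a ((insertProp b)^[m b] (insertList m l f))
    rw [ih]
    by_cases hb : b = a
    · subst hb; simp [hm]
    · generalize m b = k
      induction k with
      | zero => rfl
      | succ k ihk =>
        rw [Function.iterate_succ_apply', Function.iterate_succ_apply', ihk,
          insertProp_mulParam_of_ne hb]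

open MeasureTheory

/-! ### Schwinger integrals as integrals over all parameters -/

/-- The measure for a parameter with exponent `m`: the Lebesgue measure on `(0, ∞)` if `m > 0`, and
the point mass at `0` otherwise. -/
def schwingerMeasure (m : ℤ) : Measure ℝ :=
  if 0 < m then volume.restrict (Set.Ioi 0) else Measure.dirac 0

instance (m : ℤ) : SigmaFinite (schwingerMeasure m) := by
  unfold schwingerMeasure
  split_ifs <;> infer_instance

theorem schwingerMeasure_of_pos {m : ℤ} (hm : 0 < m) :
    schwingerMeasure m = volume.restrict (Set.Ioi 0) := if_pos hm

theorem schwingerMeasure_of_nonpos {m : ℤ} (hm : m ≤ 0) :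
    schwingerMeasure m = Measure.dirac 0 := if_neg hm.not_gt

/-- The weight for a parameter with exponent `m`. -/
def schwingerWeight (m : ℤ) (s : ℝ) : ℂ :=
  if 0 < m then Complex.I ^ m * (s : ℂ) ^ (m - 1) / Complex.Gamma m else 1

theorem schwingerWeight_of_nonpos {m : ℤ} (hm : m ≤ 0) (s : ℝ) : schwingerWeight m s = 1 :=
  if_neg hm.not_gt

theorem schwingerWeight_natCast_succ (j : ℕ) (s : ℝ) :
    schwingerWeight (j + 1) s = Complex.I ^ (j + 1) / (j.factorial : ℂ) * (s : ℂ) ^ j := by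
  rw [schwingerWeight, if_pos (by positivity)]
  push_cast
  rw [Complex.Gamma_nat_eq_factorial, add_sub_cancel_right, zpow_natCast,
    show ((j : ℤ) + 1) = ((j + 1 : ℕ) : ℤ) by push_cast; rfl, zpow_natCast]
  ring

theorem schwingerWeight_mul {m : ℤ} (hm : 0 < m) (s : ℝ) :
    schwingerWeight m s * s = -Complex.I * m * schwingerWeight (m + 1) s := by
  obtain ⟨j, rfl⟩ : ∃ j : ℕ, m = j + 1 := ⟨(m - 1).toNat, by omega⟩
  have h := schwingerWeight_natCast_succ (j + 1) s
  push_cast at h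
  rw [schwingerWeight_natCast_succ, h, Nat.factorial_succ]
  have hj : (j.factorial : ℂ) ≠ 0 := by exact_mod_cast j.factorial_ne_zero
  have hj' : (j : ℂ) + 1 ≠ 0 := by exact_mod_cast j.succ_ne_zero
  push_cast
  rw [pow_succ Complex.I (j + 1)]
  field_simp
  linear_combination (s : ℂ) ^ (j + 1) * Complex.I_sq

theorem continuous_schwingerWeight (m : ℤ) : Continuous (schwingerWeight m) := by
  rcases le_or_gt m 0 with hm | hm
  · have : schwingerWeight m = fun _ => 1 := funext fun s => schwingerWeight_of_nonpos hm s
    rw [this]; exact continuous_const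
  · obtain ⟨j, rfl⟩ : ∃ j : ℕ, m = j + 1 := ⟨(m - 1).toNat, by omega⟩
    have : schwingerWeight (j + 1) = fun s : ℝ =>
      Complex.I ^ (j + 1) / (j.factorial : ℂ) * (s : ℂ) ^ j :=
      funext fun s => schwingerWeight_natCast_succ j s
    rw [this]; fun_prop

theorem integrableOn_Ioi_pow_mul_exp (hδ : 0 < δ) (k : ℕ) :
    IntegrableOn (fun s : ℝ => (1 + |s|) ^ k * Real.exp (-δ * s)) (Set.Ioi 0) := by
  refine integrable_of_isBigO_exp_neg (b := δ / 2) (by positivity) (by fun_prop) ?_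
  have h1 : (fun s : ℝ => (1 + s) ^ k) =O[Filter.atTop] fun s => Real.exp (δ / 2 * (1 + s)) :=
    ((isLittleO_pow_exp_pos_mul_atTop k (half_pos hδ)).comp_tendsto
      (Filter.tendsto_atTop_add_const_left _ (1 : ℝ) Filter.tendsto_id)).isBigO
  have h2 := h1.mul (Asymptotics.isBigO_refl (fun s : ℝ => Real.exp (-δ * s)) Filter.atTop)
  refine (h2.congr' ?_ Filter.EventuallyEq.rfl).trans ?_
  · filter_upwards [Filter.eventually_ge_atTop 0] with s hs
    rw [abs_of_nonneg hs]
  · refine Asymptotics.IsBigO.of_bound (Real.exp (δ / 2)) (Filter.Eventually.of_forall fun s => ?_)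
    rw [← Real.exp_add, Real.norm_of_nonneg (Real.exp_nonneg _),
      Real.norm_of_nonneg (Real.exp_nonneg _), ← Real.exp_add]
    refine le_of_eq ?_
    congr 1
    ring

theorem integrable_schwingerWeight (hδ : 0 < δ) (m : ℤ) (k : ℕ) :
    Integrable (fun s : ℝ => ‖schwingerWeight m s‖ * ((1 + |s|) ^ k * Real.exp (-δ * s)))
      (schwingerMeasure m) := by
  rcases le_or_gt m 0 with hm | hm
  · rw [schwingerMeasure_of_nonpos hm]
    exact integrable_dirac (by simp)
  · rw [schwingerMeasure_of_pos hm]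
    obtain ⟨j, rfl⟩ : ∃ j : ℕ, m = j + 1 := ⟨(m - 1).toNat, by omega⟩
    refine ((integrableOn_Ioi_pow_mul_exp hδ (j + k)).const_mul
      ‖Complex.I ^ (j + 1) / (j.factorial : ℂ)‖).mono' ?_ (Filter.Eventually.of_forall fun s => ?_)
    · have := continuous_schwingerWeight (j + 1)
      exact (by fun_prop : Continuous fun s : ℝ => ‖schwingerWeight (j + 1) s‖ *
        ((1 + |s|) ^ k * Real.exp (-δ * s))).aestronglyMeasurable
    · rw [schwingerWeight_natCast_succ, Real.norm_of_nonneg (by positivity), norm_mul, norm_pow,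
        Complex.norm_real, Real.norm_eq_abs, pow_add (1 + |s|)]
      have h1 : |s| ^ j ≤ (1 + |s|) ^ j := by gcongr; linarith
      rw [mul_assoc, mul_assoc ((1 + |s|) ^ j)]
      gcongr

/-- A measurable function with exponential decay is integrable against the weights. -/
theorem integrable_weight_mul (hδ : 0 < δ) (ν : Fin p → ℤ) {f : (Fin p → ℝ) → ℂ}
    (hf : Measurable f) {C : ℝ} {k : ℕ}
    (hC : ∀ α : Fin p → ℝ, ‖f α‖ ≤ C * ∏ a, ((1 + |α a|) ^ k * Real.exp (-δ * α a))) :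
    Integrable (fun α => (∏ a, schwingerWeight (ν a) (α a)) * f α)
      (Measure.pi fun a => schwingerMeasure (ν a)) := by
  have hdom := (Integrable.fintype_prod_dep fun a =>
    integrable_schwingerWeight hδ (ν a) k).const_mul C
  refine hdom.mono' ?_ (Filter.Eventually.of_forall fun α => ?_)
  · refine (Measurable.mul ?_ hf).aestronglyMeasurable
    exact Finset.measurable_prod _ fun a _ =>
      (continuous_schwingerWeight (ν a)).measurable.comp (measurable_pi_apply a)
  · rw [norm_mul, norm_prod, Finset.prod_mul_distrib]
    refine (mul_le_mul_of_nonneg_left (hC α) (by positivity)).trans (le_of_eq ?_)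
    ring

/-- Integration by parts in one parameter. -/
theorem integral_schwingerWeight_mul {m : ℤ} (hm : 0 < m) (hδ : 0 < δ) {h h' : ℝ → ℂ}
    (hd : ∀ s, HasDerivAt h (-Complex.I * h' s) s) (hh' : Measurable h') {C : ℝ} {k : ℕ}
    (hC : ∀ s, ‖h s‖ ≤ C * ((1 + |s|) ^ k * Real.exp (-δ * s)))
    (hC' : ∀ s, ‖h' s‖ ≤ C * ((1 + |s|) ^ k * Real.exp (-δ * s))) :
    ∫ s, schwingerWeight m s * h' s ∂schwingerMeasure m =
      ∫ s, schwingerWeight (m - 1) s * h s ∂schwingerMeasure (m - 1) := by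
  obtain ⟨j, rfl⟩ : ∃ j : ℕ, m = j + 1 := ⟨(m - 1).toNat, by omega⟩
  rw [add_sub_cancel_right, schwingerMeasure_of_pos hm]
  have hcont : Continuous h := continuous_iff_continuousAt.2 fun s => (hd s).continuousAt
  have hint : ∀ (i : ℕ) {g : ℝ → ℂ}, Measurable g →
      (∀ s, ‖g s‖ ≤ C * ((1 + |s|) ^ k * Real.exp (-δ * s))) →
      IntegrableOn (fun s : ℝ => (s : ℂ) ^ i * g s) (Set.Ioi 0) := by
    intro i g hg hgC
    refine ((integrableOn_Ioi_pow_mul_exp hδ (i + k)).const_mul C).mono' ?_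
      (Filter.Eventually.of_forall fun s => ?_)
    · exact (Measurable.mul (by fun_prop) hg).aestronglyMeasurable
    · rw [norm_mul, norm_pow, Complex.norm_real, Real.norm_eq_abs]
      have h1 : |s| ^ i ≤ (1 + |s|) ^ i := by gcongr; linarith
      have h2 := (norm_nonneg _).trans (hgC s)
      calc |s| ^ i * ‖g s‖ ≤ (1 + |s|) ^ i * (C * ((1 + |s|) ^ k * Real.exp (-δ * s))) :=
            mul_le_mul h1 (hgC s) (norm_nonneg _) (by positivity)
        _ = _ := by ring
  have hH : ∀ s : ℝ, HasDerivAt (fun s : ℝ => (s : ℂ) ^ j * h s)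
      ((j : ℂ) * ((s : ℂ) ^ (j - 1) * h s) + -Complex.I * ((s : ℂ) ^ j * h' s)) s := by
    intro s
    refine (((hasDerivAt_pow j (s : ℂ)).comp_ofReal).fun_mul (hd s)).congr_deriv ?_
    ring
  have hi1 := (hint (j - 1) hcont.measurable hC).const_mul (j : ℂ)
  have hi2 := (hint j hh' hC').const_mul (-Complex.I)
  -- No boundary term at infinity, since `s ^ j h` and its derivative are both integrable.
  have hlim := tendsto_zero_of_hasDerivAt_of_integrableOn_Ioi (a := 0) (fun s _ => hH s)
    (hi1.add hi2) (hint j hcont.measurable hC)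
  have key := integral_Ioi_of_hasDerivAt_of_tendsto' (a := 0) (fun s _ => hH s) (hi1.add hi2) hlim
  rw [integral_add hi1 hi2, integral_const_mul, integral_const_mul] at key
  have hlhs : ∫ s in Set.Ioi (0 : ℝ), schwingerWeight (j + 1) s * h' s =
      Complex.I ^ (j + 1) / (j.factorial : ℂ) *
        ∫ s in Set.Ioi (0 : ℝ), (s : ℂ) ^ j * h' s := by
    rw [← integral_const_mul]
    congr 1
    funext s
    rw [schwingerWeight_natCast_succ]
    ring
  rw [hlhs]
  -- For `m = 1` the boundary term `h 0` is exactly the integral against the point mass that belongs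
  -- to exponent `0`. For `m > 1` the factor `s ^ j` kills the boundary term and the remaining
  -- integral has exponent `m - 1`.
  cases j with
  | zero =>
    rw [schwingerMeasure_of_nonpos (by simp), integral_dirac,
      schwingerWeight_of_nonpos (by simp)]
    simp only [Nat.cast_zero, zero_mul, zero_add, pow_zero, one_mul, zero_sub] at key
    simp only [pow_zero, one_mul, zero_add, pow_one, Nat.factorial_zero, Nat.cast_one, div_one]
    linear_combination -key
  | succ j =>
    have hrhs : ∫ s in Set.Ioi (0 : ℝ), schwingerWeight ((j + 1 : ℕ) : ℤ) s * h s =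
        Complex.I ^ (j + 1) / (j.factorial : ℂ) *
          ∫ s in Set.Ioi (0 : ℝ), (s : ℂ) ^ j * h s := by
      rw [← integral_const_mul]
      congr 1
      funext s
      push_cast
      rw [schwingerWeight_natCast_succ]
      ring
    rw [schwingerMeasure_of_pos (by positivity), hrhs]
    rw [Nat.add_sub_cancel] at key
    simp only [Complex.ofReal_zero, ne_eq, Nat.succ_ne_zero, not_false_eq_true, zero_pow,
      zero_mul, sub_zero] at key
    have hj : (j.factorial : ℂ) ≠ 0 := by exact_mod_cast j.factorial_ne_zero
    have hj' : (j : ℂ) + 1 ≠ 0 := by exact_mod_cast j.succ_ne_zero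
    rw [Nat.factorial_succ]
    push_cast at key ⊢
    have h2 : ∫ s in Set.Ioi (0 : ℝ), (s : ℂ) ^ (j + 1) * h' s =
        -Complex.I * (((j : ℂ) + 1) * ∫ s in Set.Ioi (0 : ℝ), (s : ℂ) ^ j * h s) := by
      linear_combination Complex.I * key +
        (∫ s in Set.Ioi (0 : ℝ), (s : ℂ) ^ (j + 1) * h' s) * Complex.I_mul_I
    rw [h2, pow_succ Complex.I (j + 1)]
    field_simp
    linear_combination -(∫ s in Set.Ioi (0 : ℝ), (s : ℂ) ^ j * h s) * Complex.I_sq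

/-- The Schwinger integral with exponents `ν`, in which `f` takes the place of the Gaussian
factor. -/
def schwingerFunctional (ν : Fin p → ℤ) (f : (Fin p → ℝ) → ℂ) : ℂ :=
  ∫ α, (∏ a, schwingerWeight (ν a) (α a)) * insertNumerator ν f α
    ∂(Measure.pi fun a => schwingerMeasure (ν a))

/-- A bound for the number of insertions. -/
def order (ν : Fin p → ℤ) : ℕ := ∑ a, (1 - ν a).toNat

theorem sum_toNat_le_order (ν : Fin p → ℤ) :
    ((List.finRange p).map fun a => (-ν a).toNat).sum ≤ order ν := by
  rw [← Fin.sum_univ_def]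
  exact Finset.sum_le_sum fun a _ => by omega

theorem order_add_single_le (ν : Fin p → ℤ) (a : Fin p) : order (ν + Pi.single a 1) ≤ order ν := by
  refine Finset.sum_le_sum fun b _ => ?_
  by_cases hb : b = a
  · subst hb; simp only [Pi.add_apply, Pi.single_eq_same]; omega
  · simp [hb]

/-- This is the reason for `1 - ν a` instead of `-ν a` in `order`: the drop must be strict at `ν a =
0` too, to pay for the derivative spent in the induction of `schwingerFunctional_mulParam`. -/
theorem order_add_single {ν : Fin p → ℤ} {a : Fin p} (ha : ν a ≤ 0) :
    order (ν + Pi.single a 1) + 1 = order ν := by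
  unfold order
  rw [← Finset.add_sum_erase _ _ (Finset.mem_univ a), ← Finset.add_sum_erase _ _ (Finset.mem_univ a)]
  have : ∑ b ∈ Finset.univ.erase a, (1 - (ν + Pi.single a 1 : Fin p → ℤ) b).toNat =
      ∑ b ∈ Finset.univ.erase a, (1 - ν b).toNat := by
    refine Finset.sum_congr rfl fun b hb => ?_
    simp [Finset.ne_of_mem_erase hb]
  rw [this]
  simp only [Pi.add_apply, Pi.single_eq_same]
  omega

theorem Nice.insertNumerator (h : IsDamped U V δ) {ν : Fin p → ℤ} {N : ℕ} {f : (Fin p → ℝ) → ℂ}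
    (hf : Nice U V (N + order ν) f) : Nice U V N (insertNumerator ν f) :=
  Nice.insertList h (hf.mono (Nat.add_le_add_left (sum_toNat_le_order ν) N))

theorem Nice.integrable (hδ : 0 < δ) (h : IsDamped U V δ) (ν μ : Fin p → ℤ) {N : ℕ}
    {f : (Fin p → ℝ) → ℂ} (hf : Nice U V (N + order μ) f) :
    Integrable (fun α => (∏ a, schwingerWeight (ν a) (α a)) * Feynman.insertNumerator μ f α)
      (Measure.pi fun a => schwingerMeasure (ν a)) := by
  have hg := hf.insertNumerator h
  obtain ⟨C, k, hC⟩ := hg.exists_bound h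
  exact integrable_weight_mul hδ ν hg.measurable hC

/-- Linearity in `P` holds because the insertions act linearly on `P` and every integrand converges.
Through `Φ`, identities between polynomials become identities between Schwinger integrals. -/
theorem exists_schwingerFunctional_eq (hδ : 0 < δ) (h : IsDamped U V δ) (ν : Fin p → ℤ) {z : ℂ}
    (hz : 2 * (order ν : ℝ) < z.re) : ∃ Φ : MvPolynomial (Fin p) ℂ →ₗ[ℂ] ℂ,
      ∀ P, schwingerFunctional ν (expFun U V z P) = Φ P := by
  have hle : (((((List.finRange p).map fun a => (-ν a).toNat).sum : ℕ)) : ℝ) ≤ order ν := by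
    exact_mod_cast sum_toNat_le_order ν
  obtain ⟨T, hT⟩ := h.exists_insertList (fun a => (-ν a).toNat) (List.finRange p) z (by linarith)
  have hint : ∀ P, Integrable (fun α => (∏ a, schwingerWeight (ν a) (α a)) *
      insertNumerator ν (expFun U V z P) α) (Measure.pi fun a => schwingerMeasure (ν a)) :=
    fun P => Nice.integrable (N := 0) hδ h ν ν ⟨z, P, by simpa using hz, rfl⟩
  have hadd : ∀ w P Q α, expFun U V w (P + Q) α = expFun U V w P α + expFun U V w Q α := by
    intro w P Q α
    unfold expFun
    split_ifs
    · rw [map_add]; ring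
    · simp
  have hsmul : ∀ w (c : ℂ) P α, expFun U V w (c • P) α = c * expFun U V w P α := by
    intro w c P α
    unfold expFun
    split_ifs
    · rw [MvPolynomial.smul_eq_C_mul, map_mul, ev_C]; ring
    · simp
  refine ⟨{ toFun := fun P => schwingerFunctional ν (expFun U V z P)
            map_add' := fun P Q => ?_
            map_smul' := fun c P => ?_ }, fun P => rfl⟩
  · rw [schwingerFunctional, schwingerFunctional, schwingerFunctional,
      ← integral_add (hint P) (hint Q)]
    congr 1
    funext α
    change _ * insertList _ _ _ α = _ * insertList _ _ _ α + _ * insertList _ _ _ α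
    rw [hT, hT, hT, map_add, hadd]
    ring
  · rw [schwingerFunctional, schwingerFunctional, RingHom.id_apply, smul_eq_mul,
      ← integral_const_mul]
    congr 1
    funext α
    change _ * insertList _ _ _ α = _ * (_ * insertList _ _ _ α)
    rw [hT, hT, map_smul, hsmul]
    ring

/-- Fubini's theorem for one distinguished parameter. -/
theorem integral_weight_mul_insertNth {q : ℕ} (ν : Fin (q + 1) → ℤ) (a : Fin (q + 1))
    (f : (Fin (q + 1) → ℝ) → ℂ)
    (hf : Integrable (fun α => (∏ b, schwingerWeight (ν b) (α b)) * f α)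
      (Measure.pi fun b => schwingerMeasure (ν b))) :
    ∫ α, (∏ b, schwingerWeight (ν b) (α b)) * f α ∂(Measure.pi fun b => schwingerMeasure (ν b)) =
      ∫ y : Fin q → ℝ, (∏ j, schwingerWeight (ν (a.succAbove j)) (y j)) *
        ∫ s, schwingerWeight (ν a) s * f (a.insertNth (α := fun _ => ℝ) s y)
          ∂schwingerMeasure (ν a)
        ∂(Measure.pi fun j => schwingerMeasure (ν (a.succAbove j))) := by
  have mp := (measurePreserving_piFinSuccAbove (fun b => schwingerMeasure (ν b)) a).symm
  have hcomp := (mp.integrable_comp_emb (MeasurableEquiv.measurableEmbedding _)).2 hf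
  rw [← mp.integral_comp (MeasurableEquiv.measurableEmbedding _)]
  refine (integral_prod_symm _ hcomp).trans ?_
  congr 1
  funext y
  rw [← integral_const_mul]
  congr 1
  funext s
  have e : (MeasurableEquiv.piFinSuccAbove (fun _ => ℝ) a).symm (s, y) =
    a.insertNth (α := fun _ => ℝ) s y := rfl
  rw [Function.comp_apply, e]
  rw [Fin.prod_univ_succAbove _ a]
  simp only [Fin.insertNth_apply_same, Fin.insertNth_apply_succAbove]
  ring

/-- Insertion of an inverse propagator lowers an exponent. -/
theorem schwingerFunctional_insertProp (hδ : 0 < δ) (h : IsDamped U V δ) {ν : Fin p → ℤ}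
    (a : Fin p) {f : (Fin p → ℝ) → ℂ} (hf : Nice U V (2 + order ν) f) :
    schwingerFunctional ν (insertProp a f) = schwingerFunctional (ν - Pi.single a 1) f := by
  have hsum := sum_toNat_le_order ν
  have hcomm : insertNumerator ν (insertProp a f) = insertProp a (insertNumerator ν f) :=
    Nice.insertList_comm h a (hf.mono (by omega))
  have hsub : ∀ b ≠ a, (ν - Pi.single a 1 : Fin p → ℤ) b = ν b := fun b hb => by simp [hb]
  rcases le_or_gt (ν a) 0 with ha | ha
  -- For `ν a ≤ 0` the exponent only counts insertions; weight and measure do not change.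
  · have h1 : insertNumerator (ν - Pi.single a 1) f = insertProp a (insertNumerator ν f) := by
      refine Nice.insertList_succ h (List.nodup_finRange p) (List.mem_finRange a) ?_ ?_
        (hf.mono (by omega))
      · simp only [Pi.sub_apply, Pi.single_eq_same]; omega
      · intro b hb
        rw [hsub b hb]
    rw [schwingerFunctional, schwingerFunctional, hcomm, h1]
    have h2 : ∀ b, schwingerMeasure ((ν - Pi.single a 1 : Fin p → ℤ) b) =
        schwingerMeasure (ν b) := by
      intro b
      by_cases hb : b = a
      · subst hb
        rw [schwingerMeasure_of_nonpos ha, schwingerMeasure_of_nonpos (by simp; omega)]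
      · rw [hsub b hb]
    have h3 : ∀ b s, schwingerWeight ((ν - Pi.single a 1 : Fin p → ℤ) b) s =
        schwingerWeight (ν b) s := by
      intro b s
      by_cases hb : b = a
      · subst hb
        rw [schwingerWeight_of_nonpos ha, schwingerWeight_of_nonpos (by simp; omega)]
      · rw [hsub b hb]
    simp only [h2, h3]
  -- For `ν a > 0` neither exponent inserts `a`, even when `ν a - 1 = 0`; the shift is an
  -- integration by parts in `α a` inside Fubini's theorem.
  · have h1 : insertNumerator (ν - Pi.single a 1) f = insertNumerator ν f := by
      refine insertList_congr (fun b _ => ?_) f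
      by_cases hb : b = a
      · subst hb
        simp only [Pi.sub_apply, Pi.single_eq_same]; omega
      · rw [hsub b hb]
    have hg : Nice U V 2 (insertNumerator ν f) := hf.insertNumerator h
    have hg' : Nice U V 1 (insertProp a (insertNumerator ν f)) := hg.insertProp h a
    obtain ⟨C, k, hC⟩ := hg.exists_bound h
    obtain ⟨C', k', hC'⟩ := hg'.exists_bound h
    have hint := integrable_weight_mul hδ ν hg'.measurable hC'
    have hint' := integrable_weight_mul hδ (ν - Pi.single a 1) hg.measurable hC
    rw [schwingerFunctional, schwingerFunctional, hcomm, h1]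
    obtain ⟨q, rfl⟩ : ∃ q, p = q + 1 := ⟨p - 1, by have := a.2; omega⟩
    rw [integral_weight_mul_insertNth ν a _ hint,
      integral_weight_mul_insertNth (ν - Pi.single a 1) a _ hint']
    have h2 : ∀ j, (ν - Pi.single a 1 : Fin (q + 1) → ℤ) (a.succAbove j) = ν (a.succAbove j) :=
      fun j => hsub _ (Fin.succAbove_ne a j)
    simp only [h2]
    congr 1
    funext y
    congr 1
    have h3 : (ν - Pi.single a 1 : Fin (q + 1) → ℤ) a = ν a - 1 := by simp
    rw [h3]
    -- One constant for both functions on the slice with the other parameters fixed at `y`; absolute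
    -- values, since the signs of `C` and `C'` are not known.
    set K : ℝ := |C| * ∏ j, ((1 + |y j|) ^ k * Real.exp (-δ * y j)) +
      |C'| * ∏ j, ((1 + |y j|) ^ k' * Real.exp (-δ * y j)) with hK
    have hbound : ∀ (c : ℝ) (i : ℕ), i ≤ k + k' →
        |c| * ∏ j, ((1 + |y j|) ^ i * Real.exp (-δ * y j)) ≤ K → ∀ s : ℝ,
        c * ∏ b, ((1 + |(a.insertNth (α := fun _ => ℝ) s y : Fin (q + 1) → ℝ) b|) ^ i *
          Real.exp (-δ * (a.insertNth (α := fun _ => ℝ) s y : Fin (q + 1) → ℝ) b)) ≤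
        K * ((1 + |s|) ^ (k + k') * Real.exp (-δ * s)) := by
      intro c i hi hc s
      rw [Fin.prod_univ_succAbove _ a]
      simp only [Fin.insertNth_apply_same, Fin.insertNth_apply_succAbove]
      have hs : (1 + |s|) ^ i ≤ (1 + |s|) ^ (k + k') :=
        pow_le_pow_right₀ (by linarith [abs_nonneg s]) hi
      calc _ ≤ |c| * ((1 + |s|) ^ i * Real.exp (-δ * s) *
            ∏ j, ((1 + |y j|) ^ i * Real.exp (-δ * y j))) :=
            mul_le_mul_of_nonneg_right (le_abs_self c) (by positivity)
        _ = (|c| * ∏ j, ((1 + |y j|) ^ i * Real.exp (-δ * y j))) *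
            ((1 + |s|) ^ i * Real.exp (-δ * s)) := by ring
        _ ≤ K * ((1 + |s|) ^ (k + k') * Real.exp (-δ * s)) := by
            have : 0 ≤ K := by positivity
            gcongr
    have hmeas : Measurable fun s : ℝ => (a.insertNth (α := fun _ => ℝ) s y : Fin (q + 1) → ℝ) := by
      refine measurable_pi_iff.2 fun b => ?_
      rcases Fin.eq_self_or_eq_succAbove a b with rfl | ⟨j, rfl⟩
      · simpa using measurable_id'
      · simp
    refine integral_schwingerWeight_mul ha hδ (C := K) (k := k + k') (fun s => ?_)
      (hg'.measurable.comp hmeas) (fun s => (hC _).trans (hbound C k (by omega) ?_ s))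
      (fun s => (hC' _).trans (hbound C' k' (by omega) ?_ s))
    · have := (hg.mono (by norm_num) : Nice U V (1 + 1) _).hasDerivAt h a
        (a.insertNth (α := fun _ => ℝ) 0 y) s
      simpa only [Fin.update_insertNth] using this
    · rw [hK]
      exact le_add_of_nonneg_right (by positivity)
    · rw [hK]
      exact le_add_of_nonneg_left (by positivity)

/-- The commutator of `i ∂_a` with `α_a` is `i`; the factor `U ^ 2` compensates the passage from `z`
to `z - 2`. -/
theorem insOp_X_mul (a : Fin p) (z : ℂ) (P : MvPolynomial (Fin p) ℂ) :
    insOp U V a z (MvPolynomial.X a * P) =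
      Complex.I • (U ^ 2 * P) + MvPolynomial.X a * insOp U V a z P := by
  simp only [insOp_apply, MvPolynomial.pderiv_mul, MvPolynomial.pderiv_X_self,
    MvPolynomial.smul_eq_C_mul]
  ring

theorem expFun_sub_two (z : ℂ) (P : MvPolynomial (Fin p) ℂ) :
    expFun U V (z - 2) (U ^ 2 * P) = expFun U V z P := by
  funext α
  unfold expFun
  split_ifs with hu
  · have hne : ev α U ≠ 0 := fun h0 => by simp [h0] at hu
    rw [Complex.cpow_sub _ _ hne, show ev α U ^ (2 : ℂ) = ev α U ^ 2 by
      exact_mod_cast Complex.cpow_natCast _ 2, map_mul, map_pow]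
    field_simp
  · rfl

/-- Multiplication with a Schwinger parameter raises an exponent. -/
theorem schwingerFunctional_mulParam (hδ : 0 < δ) (h : IsDamped U V δ) (a : Fin p) (k : ℕ) :
    ∀ {ν : Fin p → ℤ} {f : (Fin p → ℝ) → ℂ}, (1 - ν a).toNat = k → Nice U V (3 + order ν) f →
    schwingerFunctional ν (mulParam a f) =
      -Complex.I * ν a * schwingerFunctional (ν + Pi.single a 1) f := by
  have hadd : ∀ ν : Fin p → ℤ, ∀ b ≠ a, (ν + Pi.single a 1 : Fin p → ℤ) b = ν b :=
    fun ν b hb => by simp [hb]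
  induction k with
  | zero =>
    intro ν f hν _
    have ha : 0 < ν a := by omega
    have h1 : insertNumerator ν (mulParam a f) = mulParam a (insertNumerator ν f) :=
      insertList_mulParam (by omega) _ f
    have h2 : insertNumerator (ν + Pi.single a 1) f = insertNumerator ν f := by
      refine insertList_congr (fun b _ => ?_) f
      by_cases hb : b = a
      · subst hb
        simp only [Pi.add_apply, Pi.single_eq_same]; omega
      · rw [hadd ν b hb]
    have h3 : ∀ b, schwingerMeasure ((ν + Pi.single a 1 : Fin p → ℤ) b) =
        schwingerMeasure (ν b) := by
      intro b
      by_cases hb : b = a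
      · subst hb
        rw [schwingerMeasure_of_pos ha, schwingerMeasure_of_pos (by simp; omega)]
      · rw [hadd ν b hb]
    rw [schwingerFunctional, schwingerFunctional, h1, h2, ← integral_const_mul]
    simp only [h3]
    congr 1
    funext α
    have h4 := schwingerWeight_mul ha (α a)
    have h5 : (ν + Pi.single a 1 : Fin p → ℤ) a = ν a + 1 := by simp
    have h6 := hadd ν
    generalize (ν + Pi.single a 1 : Fin p → ℤ) = ν' at h5 h6 ⊢
    rw [← Finset.mul_prod_erase _ (fun b => schwingerWeight (ν b) (α b)) (Finset.mem_univ a),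
      ← Finset.mul_prod_erase _ (fun b => schwingerWeight (ν' b) (α b)) (Finset.mem_univ a),
      Finset.prod_congr rfl fun b hb => by rw [← h6 b (Finset.ne_of_mem_erase hb)], h5, mulParam]
    linear_combination (∏ b ∈ Finset.univ.erase a,
      schwingerWeight (ν' b) (α b)) * insertNumerator ν f α * h4
  | succ k ih =>
    -- With `S_ν` the functional and `ν' = ν + e_a`, raising the exponent once gives `S_ν(α_a f) =
    -- S_ν'(i ∂_a (α_a f)) = i S_ν'(f) + S_ν'(α_a i ∂_a f)`. By induction the last term is `-i (ν_a
    -- + 1) S_ν'(f)`, and the sum is `-i ν_a S_ν'(f)`.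
    intro ν f hν hf
    have ha : ν a ≤ 0 := by omega
    have hord := order_add_single ha
    have hord' := order_add_single_le (ν + Pi.single a 1) a
    have hν' : (ν + Pi.single a 1 : Fin p → ℤ) a = ν a + 1 := by simp
    have e1 : schwingerFunctional ν (mulParam a f) =
        schwingerFunctional (ν + Pi.single a 1) (insertProp a (mulParam a f)) := by
      rw [schwingerFunctional_insertProp hδ h a ((hf.mono (by omega)).mulParam a),
        add_sub_cancel_right]
    have e2 : schwingerFunctional (ν + Pi.single a 1) (insertProp a (mulParam a f)) =
        Complex.I * schwingerFunctional (ν + Pi.single a 1) f +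
          schwingerFunctional (ν + Pi.single a 1) (mulParam a (insertProp a f)) := by
      obtain ⟨z, P, hz, rfl⟩ := hf
      have h0 : (0 : ℝ) ≤ order (ν + Pi.single a 1) := Nat.cast_nonneg _
      have hz1 : 2 * (order (ν + Pi.single a 1) : ℝ) + 8 < z.re := by
        rw [← hord] at hz
        push_cast at hz
        linarith
      -- All three functions are written with the exponent `z - 2`, so that a single linear `Φ`
      -- carries the Leibniz rule for polynomials to the integrals.
      obtain ⟨Φ, hΦ⟩ := exists_schwingerFunctional_eq hδ h (ν + Pi.single a 1) (z := z - 2) (by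
        simp only [Complex.sub_re, Complex.re_ofNat]; linarith)
      rw [mulParam_expFun, h.insertProp_expFun (by linarith), h.insertProp_expFun (by linarith),
        mulParam_expFun, ← expFun_sub_two z P, hΦ, hΦ, hΦ, insOp_X_mul, map_add, map_smul,
        smul_eq_mul]
    have e3 := ih (ν := ν + Pi.single a 1) (f := insertProp a f) (by rw [hν']; omega)
      ((hf.mono (by omega) : Nice U V (3 + order (ν + Pi.single a 1) + 1) f).insertProp h a)
    rw [schwingerFunctional_insertProp hδ h a (hf.mono (by omega)), add_sub_cancel_right,
      hν'] at e3
    rw [e1, e2, e3]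
    push_cast
    ring

/-! ### Comparison with the Schwinger parametrisation -/

theorem pi_dirac {ι : Type*} [Fintype ι] (x : ι → ℝ) :
    Measure.pi (fun i => Measure.dirac (x i)) = Measure.dirac x := by
  refine Measure.pi_eq fun s hs => ?_
  rw [Measure.dirac_apply' _ (MeasurableSet.univ_pi hs)]
  simp only [Measure.dirac_apply' _ (hs _)]
  by_cases hx : ∀ i, x i ∈ s i
  · rw [Set.indicator_of_mem (Set.mem_univ_pi.2 hx), Finset.prod_eq_one]
    · rfl
    · intro i _
      rw [Set.indicator_of_mem (hx i)]; rfl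
  · rw [Set.indicator_of_notMem (fun h0 => hx (Set.mem_univ_pi.1 h0))]
    push Not at hx
    obtain ⟨i, hi⟩ := hx
    rw [Finset.prod_eq_zero (Finset.mem_univ i)]
    rw [Set.indicator_of_notMem hi]

/-- Splitting the product measure by the sign of the exponents, the nonpositive ones contribute a
point mass at the zero vector, which is what `extendZero` inserts. -/
theorem measurePreserving_extendZero (ν : Fin p → ℤ) :
    MeasurePreserving (extendZero ν) (volume.restrict (orthant ν))
      (Measure.pi fun a => schwingerMeasure (ν a)) := by
  have mp := (measurePreserving_piEquivPiSubtypeProd (fun a => schwingerMeasure (ν a))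
    (fun a => 0 < ν a)).symm
  have h1 : (Measure.pi fun a : {a // 0 < ν a} => schwingerMeasure (ν a)) =
      volume.restrict (orthant ν) := by
    have : (fun a : {a // 0 < ν a} => schwingerMeasure (ν a)) =
        fun _ => volume.restrict (Set.Ioi 0) := funext fun a => schwingerMeasure_of_pos a.2
    rw [this, ← Measure.restrict_pi_pi, ← volume_pi]
    congr 1
    ext α
    simp [orthant]
  have h2 : (Measure.pi fun a : {a // ¬ 0 < ν a} => schwingerMeasure (ν a)) =
      Measure.dirac 0 := by
    rw [← pi_dirac]
    congr 1
    funext a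
    exact schwingerMeasure_of_nonpos (not_lt.1 a.2)
  rw [h1, h2, Measure.prod_dirac] at mp
  have mp' : MeasurePreserving (fun x : {a // 0 < ν a} → ℝ => (x, (0 : {a // ¬ 0 < ν a} → ℝ)))
      (volume.restrict (orthant ν)) ((volume.restrict (orthant ν)).map fun x => (x, 0)) :=
    ⟨by fun_prop, rfl⟩
  exact mp.comp mp'

theorem schwingerIntegrand_eq (F : Family L n p) (x : Scale n p → ℂ) (ν : Fin p → ℤ) (D : ℂ) :
    F.schwingerIntegrand x ν D = (fun α => (∏ a, schwingerWeight (ν a) (α a)) *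
      insertNumerator ν (F.gaussian x D) α) ∘ extendZero ν := by
  funext α
  rw [Family.schwingerIntegrand, Function.comp_apply]
  congr 1
  rw [← Fintype.prod_subtype_mul_prod_subtype (fun a => 0 < ν a)
    (fun a => schwingerWeight (ν a) (extendZero ν α a)),
    Finset.prod_eq_one (s := (Finset.univ : Finset {a // ¬ 0 < ν a})), mul_one]
  · refine Finset.prod_congr rfl fun a _ => ?_
    simp [schwingerWeight, extendZero, a.2]
  · intro a _
    exact schwingerWeight_of_nonpos (not_lt.1 a.2) _

theorem schwingerIntegrand_integrable_and_integral (F : Family L n p) (x : Scale n p → ℂ)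
    (ν : Fin p → ℤ) (D : ℂ) (hδ : 0 < δ) (h : IsDamped U V δ) {N : ℕ}
    (hG : Nice U V (N + order ν) (F.gaussian x D)) :
    IntegrableOn (F.schwingerIntegrand x ν D) (orthant ν) ∧
      ∫ α in orthant ν, F.schwingerIntegrand x ν D α =
        schwingerFunctional ν (F.gaussian x D) := by
  have hint := hG.integrable hδ h ν ν
  have mp := measurePreserving_extendZero ν
  rw [schwingerIntegrand_eq]
  refine ⟨(mp.integrable_comp hint.aestronglyMeasurable).2 hint, ?_⟩
  rw [schwingerFunctional, ← mp.map_eq, integral_map mp.measurable.aemeasurable]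
  · rfl
  · rw [mp.map_eq]; exact hint.aestronglyMeasurable

/-! ### The Symanzik polynomials as polynomials -/

/-- The matrix `det A * C - Bᵀ * adj A * B`. -/
def schurNumerator {R : Type*} [CommRing R] (A : Matrix (Fin L) (Fin L) R)
    (B : Matrix (Fin L) (Fin n) R) (C : Matrix (Fin n) (Fin n) R) : Matrix (Fin n) (Fin n) R :=
  A.det • C - B.transpose * A.adjugate * B

theorem schurNumerator_map {R S : Type*} [CommRing R] [CommRing S] (f : R →+* S)
    (A : Matrix (Fin L) (Fin L) R) (B : Matrix (Fin L) (Fin n) R) (C : Matrix (Fin n) (Fin n) R) :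
    (schurNumerator A B C).map f = schurNumerator (A.map f) (B.map f) (C.map f) := by
  have h1 : (A.map f).adjugate = A.adjugate.map f := (f.map_adjugate A).symm
  have h2 : (A.map f).det = f A.det := (f.map_det A).symm
  ext i j
  simp only [schurNumerator, h1, h2, Matrix.map_apply, Matrix.sub_apply, Matrix.smul_apply,
    smul_eq_mul, map_sub, map_mul, Matrix.mul_apply, Matrix.transpose_apply, map_sum]

/-- The matrix of `∑ a, α_a q_a ^ 2` as a polynomial in the Schwinger parameters. -/
def Family.polyMatrix (F : Family L n p) {ι κ : Type*} (f : ι → Mom L n) (g : κ → Mom L n) :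
    Matrix ι κ (MvPolynomial (Fin p) ℂ) :=
  Matrix.of fun i j => ∑ a, MvPolynomial.X a *
    MvPolynomial.C ((F.coeff a (f i) : ℂ) * (F.coeff a (g j) : ℂ))

/-- The first Symanzik polynomial. -/
def Family.polyU (F : Family L n p) : MvPolynomial (Fin p) ℂ :=
  (F.polyMatrix Sum.inl Sum.inl).det

/-- The second Symanzik polynomial. -/
def Family.polyF (F : Family L n p) (x : Scale n p → ℂ) : MvPolynomial (Fin p) ℂ :=
  F.polyU * ∑ a, MvPolynomial.C (x (Sum.inr a)) * MvPolynomial.X a -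
    ∑ i, ∑ j, schurNumerator (F.polyMatrix Sum.inl Sum.inl) (F.polyMatrix Sum.inl Sum.inr)
      (F.polyMatrix Sum.inr Sum.inr) i j * MvPolynomial.C (x (Sum.inl s(i, j)))

theorem Family.loopMatrix_map (F : Family L n p) (α : Fin p → ℝ) :
    (F.loopMatrix α).map Complex.ofRealHom = (F.polyMatrix Sum.inl Sum.inl).map (ev α) := by
  ext i j; simp [Family.loopMatrix, Family.polyMatrix, map_sum]

theorem Family.mixedMatrix_map (F : Family L n p) (α : Fin p → ℝ) :
    (F.mixedMatrix α).map Complex.ofRealHom = (F.polyMatrix Sum.inl Sum.inr).map (ev α) := by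
  ext i j; simp [Family.mixedMatrix, Family.polyMatrix, map_sum]

theorem Family.extMatrix_map (F : Family L n p) (α : Fin p → ℝ) :
    (F.extMatrix α).map Complex.ofRealHom = (F.polyMatrix Sum.inr Sum.inr).map (ev α) := by
  ext i j; simp [Family.extMatrix, Family.polyMatrix, map_sum]

theorem Family.ev_polyU (F : Family L n p) (α : Fin p → ℝ) : ev α F.polyU = F.symanzikU α := by
  have h1 : ev α F.polyU = ((F.polyMatrix Sum.inl Sum.inl).map (ev α)).det := (ev α).map_det _
  rw [h1, ← F.loopMatrix_map]
  exact (Complex.ofRealHom.map_det _).symm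

theorem Family.ev_polyF (F : Family L n p) (x : Scale n p → ℂ) (α : Fin p → ℝ) :
    ev α (F.polyF x) = F.symanzikF x α := by
  have h1 : ∀ i j, ev α (schurNumerator (F.polyMatrix Sum.inl Sum.inl)
      (F.polyMatrix Sum.inl Sum.inr) (F.polyMatrix Sum.inr Sum.inr) i j) =
      ((schurNumerator (F.loopMatrix α) (F.mixedMatrix α) (F.extMatrix α) i j : ℝ) : ℂ) := by
    intro i j
    have h2 := schurNumerator_map (ev α) (F.polyMatrix Sum.inl Sum.inl)
      (F.polyMatrix Sum.inl Sum.inr) (F.polyMatrix Sum.inr Sum.inr)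
    rw [← F.loopMatrix_map, ← F.mixedMatrix_map, ← F.extMatrix_map, ← schurNumerator_map] at h2
    exact congrFun (congrFun h2 i) j
  rw [Family.polyF, map_sub, map_mul, F.ev_polyU]
  simp only [map_sum, map_mul, h1, ev_C, ev_X]
  rfl

theorem Family.gaussian_eq_expFun (F : Family L n p) (x : Scale n p → ℂ) (D : ℂ) :
    F.gaussian x D = expFun F.polyU (F.polyF x) (-D / 2) 1 := by
  funext α
  simp only [Family.gaussian, expFun, F.ev_polyU, F.ev_polyF, Complex.ofReal_re, map_one, one_mul]

/-- For real scales the only imaginary part of `F / U` comes from `-i δ ∑ a, α a`; everything else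
is a phase. -/
theorem Family.isDamped (F : Family L n p) (x : Scale n p → ℝ) (δ : ℝ) :
    IsDamped F.polyU (F.polyF (shiftScales x δ)) δ where
  im_eq α := by rw [F.ev_polyU, Complex.ofReal_im]
  norm_exp α hα := by
    rw [F.ev_polyU, Complex.ofReal_re] at hα
    have hne : (F.symanzikU α : ℂ) ≠ 0 := by exact_mod_cast hα.ne'
    have hF : F.symanzikF (shiftScales x δ) α = (F.symanzikU α : ℂ) *
        (((∑ a, x (Sum.inr a) * α a : ℝ) : ℂ) - Complex.I * ((δ * ∑ a, α a : ℝ) : ℂ)) -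
        ((∑ i, ∑ j, (F.symanzikU α • F.extMatrix α - (F.mixedMatrix α).transpose *
          (F.loopMatrix α).adjugate * F.mixedMatrix α) i j * x (Sum.inl s(i, j)) : ℝ) : ℂ) := by
      rw [Family.symanzikF]
      congr 1
      · congr 1
        push_cast
        rw [Finset.mul_sum, Finset.mul_sum, ← Finset.sum_sub_distrib]
        refine Finset.sum_congr rfl fun a _ => ?_
        simp only [shiftScales, Sum.elim_inr]
        ring
      · simp [shiftScales]
    rw [F.ev_polyU, F.ev_polyF, hF, Complex.norm_exp]
    congr 1
    generalize (∑ i, ∑ j, (F.symanzikU α • F.extMatrix α - (F.mixedMatrix α).transpose *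
          (F.loopMatrix α).adjugate * F.mixedMatrix α) i j * x (Sum.inl s(i, j)) : ℝ) = y
    generalize (∑ a, x (Sum.inr a) * α a : ℝ) = w
    have : -Complex.I * ((F.symanzikU α : ℂ) * ((w : ℂ) - Complex.I * ((δ * ∑ a, α a : ℝ) : ℂ)) -
        (y : ℂ)) / (F.symanzikU α : ℂ) = ((-δ * ∑ a, α a : ℝ) : ℂ) +
        ((y / F.symanzikU α - w : ℝ) : ℂ) * Complex.I := by
      push_cast
      field_simp
      ring_nf
      simp only [Complex.I_sq]
      ring
    rw [this]
    simp

/-! ### Rank one updates -/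

section RankOne

variable {ι κ : Type*} [Fintype ι] [DecidableEq ι] {A : Matrix ι ι ℝ}
  {B : Matrix ι κ ℝ} {C : Matrix κ κ ℝ}

open Matrix

theorem det_add_smul_vecMulVec (hA : A.det ≠ 0) (v : ι → ℝ) (c : ℝ) :
    (A + c • vecMulVec v v).det = A.det * (1 + c * (v ⬝ᵥ A⁻¹ *ᵥ v)) := by
  have h1 : c • vecMulVec v v = replicateCol Unit (c • v) * replicateRow Unit v := by
    ext i j; simp [vecMulVec_apply, Matrix.mul_apply, mul_assoc]
  rw [h1, det_add_replicateCol_mul_replicateRow (isUnit_iff_ne_zero.2 hA)]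
  congr 1
  rw [det_unique, Matrix.add_apply, Matrix.one_apply_eq, Matrix.mul_assoc,
    ← Matrix.replicateCol_mulVec, Matrix.replicateRow_mul_replicateCol_apply, mulVec_smul,
    dotProduct_smul, smul_eq_mul]

/-- A change of one Schwinger parameter adds a multiple of one square `q_b ^ 2` to the quadratic
form. The Schur complement, the form after elimination of the loop momenta, then also changes by
rank one, as in the Sherman–Morrison formula. -/
theorem schur_add_smul_vecMulVec (hA : A.det ≠ 0) (hsymm : A.transpose = A) (v : ι → ℝ)
    (β : κ → ℝ) {c : ℝ} (hc : 1 + c * (v ⬝ᵥ A⁻¹ *ᵥ v) ≠ 0) :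
    (C + c • vecMulVec β β) - (B + c • vecMulVec v β).transpose *
        (A + c • vecMulVec v v)⁻¹ * (B + c • vecMulVec v β) =
      C - B.transpose * A⁻¹ * B + (c / (1 + c * (v ⬝ᵥ A⁻¹ *ᵥ v))) •
        vecMulVec (β - v ᵥ* (A⁻¹ * B)) (β - v ᵥ* (A⁻¹ * B)) := by
  set k := v ⬝ᵥ A⁻¹ *ᵥ v with hk
  set y := v ᵥ* (A⁻¹ * B) with hy
  have hA' : IsUnit (A + c • vecMulVec v v).det := by
    rw [det_add_smul_vecMulVec hA]
    exact isUnit_iff_ne_zero.2 (mul_ne_zero hA hc)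
  have hAu : IsUnit A.det := isUnit_iff_ne_zero.2 hA
  have hsol : (A + c • vecMulVec v v)⁻¹ * (B + c • vecMulVec v β) =
      A⁻¹ * B + (c / (1 + c * k)) • vecMulVec (A⁻¹ *ᵥ v) (β - y) := by
    have h1 : A * (A⁻¹ * B) = B := Matrix.mul_nonsing_inv_cancel_left A B hAu
    have h2 : A *ᵥ (A⁻¹ *ᵥ v) = v := by
      rw [mulVec_mulVec, Matrix.mul_nonsing_inv A hAu, one_mulVec]
    -- Only the solution of one linear system is needed, so the candidate is multiplied out and the
    -- updated inverse is never computed.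
    have h3 : (A + c • vecMulVec v v) *
        (A⁻¹ * B + (c / (1 + c * k)) • vecMulVec (A⁻¹ *ᵥ v) (β - y)) = B + c • vecMulVec v β := by
      rw [Matrix.add_mul, Matrix.mul_add, Matrix.mul_add, h1, Matrix.mul_smul, mul_vecMulVec, h2,
        Matrix.smul_mul, vecMulVec_mul, Matrix.smul_mul, Matrix.mul_smul, vecMulVec_mul,
        vecMul_vecMulVec, ← hy, ← hk]
      ext i j
      simp only [Matrix.add_apply, Matrix.smul_apply, vecMulVec_apply, Pi.sub_apply, Pi.smul_apply,
        smul_eq_mul]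
      field_simp
      ring
    rw [← h3, Matrix.nonsing_inv_mul_cancel_left _ _ hA']
  have hy' : B.transpose *ᵥ (A⁻¹ *ᵥ v) = y := by
    rw [hy, ← Matrix.mulVec_transpose, Matrix.transpose_mul, Matrix.transpose_nonsing_inv, hsymm,
      mulVec_mulVec]
  rw [Matrix.mul_assoc, hsol, Matrix.transpose_add, Matrix.transpose_smul, transpose_vecMulVec,
    Matrix.add_mul, Matrix.mul_add, Matrix.mul_add, Matrix.mul_smul, mul_vecMulVec, hy',
    Matrix.smul_mul, vecMulVec_mul, ← hy, Matrix.smul_mul, Matrix.mul_smul, vecMulVec_mul,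
    vecMul_vecMulVec, ← hk, ← Matrix.mul_assoc]
  ext i j
  simp only [Matrix.add_apply, Matrix.sub_apply, Matrix.smul_apply, vecMulVec_apply, Pi.sub_apply,
    Pi.smul_apply, smul_eq_mul]
  field_simp
  ring

end RankOne

/-! ### Derivatives of the Gaussian factor -/

theorem sum_update_mul (α : Fin p → ℝ) (b : Fin p) (s : ℝ) (f : Fin p → ℝ) :
    ∑ a, Function.update α b s a * f a = ∑ a, α a * f a + (s - α b) * f b := by
  rw [← Finset.add_sum_erase _ _ (Finset.mem_univ b),
    ← Finset.add_sum_erase _ (fun a => α a * f a) (Finset.mem_univ b)]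
  have : ∑ a ∈ Finset.univ.erase b, Function.update α b s a * f a =
      ∑ a ∈ Finset.univ.erase b, α a * f a :=
    Finset.sum_congr rfl fun a ha => by rw [Function.update_of_ne (Finset.ne_of_mem_erase ha)]
  rw [this, Function.update_self]
  ring

/-- The coefficients of the loop momenta in the propagator `b`. -/
def Family.loopVec (F : Family L n p) (b : Fin p) (i : Fin L) : ℝ := F.coeff b (Sum.inl i)

/-- The coefficients of the external momenta in the propagator `b`. -/
def Family.extVec (F : Family L n p) (b : Fin p) (j : Fin n) : ℝ := F.coeff b (Sum.inr j)

theorem Family.loopMatrix_update (F : Family L n p) (α : Fin p → ℝ) (b : Fin p) (s : ℝ) :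
    F.loopMatrix (Function.update α b s) =
      F.loopMatrix α + (s - α b) • Matrix.vecMulVec (F.loopVec b) (F.loopVec b) := by
  ext i j
  simp only [Family.loopMatrix, Matrix.of_apply, sum_update_mul, Matrix.add_apply,
    Matrix.smul_apply, Matrix.vecMulVec_apply, smul_eq_mul, Family.loopVec]

theorem Family.mixedMatrix_update (F : Family L n p) (α : Fin p → ℝ) (b : Fin p) (s : ℝ) :
    F.mixedMatrix (Function.update α b s) =
      F.mixedMatrix α + (s - α b) • Matrix.vecMulVec (F.loopVec b) (F.extVec b) := by
  ext i j
  simp only [Family.mixedMatrix, Matrix.of_apply, sum_update_mul, Matrix.add_apply,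
    Matrix.smul_apply, Matrix.vecMulVec_apply, smul_eq_mul, Family.loopVec, Family.extVec]

theorem Family.extMatrix_update (F : Family L n p) (α : Fin p → ℝ) (b : Fin p) (s : ℝ) :
    F.extMatrix (Function.update α b s) =
      F.extMatrix α + (s - α b) • Matrix.vecMulVec (F.extVec b) (F.extVec b) := by
  ext i j
  simp only [Family.extMatrix, Matrix.of_apply, sum_update_mul, Matrix.add_apply,
    Matrix.smul_apply, Matrix.vecMulVec_apply, smul_eq_mul, Family.extVec]

theorem Family.loopMatrix_transpose (F : Family L n p) (α : Fin p → ℝ) :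
    (F.loopMatrix α).transpose = F.loopMatrix α := by
  ext i j
  simp only [Family.loopMatrix, Matrix.transpose_apply, Matrix.of_apply]
  exact Finset.sum_congr rfl fun a _ => by ring

theorem Family.loopMatrix_inv_symm (F : Family L n p) (α : Fin p → ℝ) (i j : Fin L) :
    (F.loopMatrix α)⁻¹ i j = (F.loopMatrix α)⁻¹ j i := by
  conv_lhs => rw [← F.loopMatrix_transpose α, ← Matrix.transpose_nonsing_inv,
    Matrix.transpose_apply]

theorem Family.symanzikF_div (F : Family L n p) (x : Scale n p → ℂ) {α : Fin p → ℝ}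
    (hU : F.symanzikU α ≠ 0) :
    F.symanzikF x α / F.symanzikU α = ∑ a, x (Sum.inr a) * (α a : ℂ) -
      ∑ i, ∑ j, (((F.extMatrix α - (F.mixedMatrix α).transpose * (F.loopMatrix α)⁻¹ *
        F.mixedMatrix α) i j : ℝ) : ℂ) * x (Sum.inl s(i, j)) := by
  have hinv : (F.loopMatrix α)⁻¹ = (F.symanzikU α)⁻¹ • (F.loopMatrix α).adjugate := by
    rw [Matrix.inv_def, Ring.inverse_eq_inv']; rfl
  have h1 : ∀ i j, ((F.symanzikU α • F.extMatrix α - (F.mixedMatrix α).transpose *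
      (F.loopMatrix α).adjugate * F.mixedMatrix α) i j : ℝ) = F.symanzikU α *
      (F.extMatrix α - (F.mixedMatrix α).transpose * (F.loopMatrix α)⁻¹ * F.mixedMatrix α) i j := by
    intro i j
    rw [hinv, Matrix.mul_smul, Matrix.smul_mul]
    simp only [Matrix.sub_apply, Matrix.smul_apply, smul_eq_mul]
    field_simp
  have hne : (F.symanzikU α : ℂ) ≠ 0 := by exact_mod_cast hU
  rw [Family.symanzikF, div_eq_iff hne]
  simp only [h1]
  push_cast
  simp only [mul_assoc, ← Finset.mul_sum]
  ring

/-- The coefficients of the external momenta in the stationary point of the exponent. -/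
def Family.mean (F : Family L n p) (α : Fin p → ℝ) : Mom L n → Fin n → ℝ :=
  Sum.elim (fun i j => -((F.loopMatrix α)⁻¹ * F.mixedMatrix α) i j) fun j => Pi.single j 1

/-- The covariance of the momenta, up to a factor. -/
def Family.cov (F : Family L n p) (α : Fin p → ℝ) : Mom L n → Mom L n → ℝ :=
  Sum.elim (fun i => Sum.elim (fun j => (F.loopMatrix α)⁻¹ i j) fun _ => 0) fun _ _ => 0

theorem Family.cov_comm (F : Family L n p) (α : Fin p → ℝ) (t u : Mom L n) :
    F.cov α t u = F.cov α u t := by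
  rcases t with i | j <;> rcases u with i' | j' <;> simp [Family.cov]
  exact F.loopMatrix_inv_symm α i i'

/-- The expectation values of dot products in the Gaussian integral over the loop momenta. -/
def Family.gaussMean (F : Family L n p) (x : Scale n p → ℂ) (D : ℂ) (α : Fin p → ℝ) :
    Sym2 (Mom L n) → ℂ :=
  Sym2.lift ⟨fun t u => ∑ j, ∑ l, (F.mean α t j : ℂ) * (F.mean α u l : ℂ) * x (Sum.inl s(j, l)) +
    Complex.I * D / 2 * (F.cov α t u : ℂ), fun t u => by
      beta_reduce
      rw [F.cov_comm, Finset.sum_comm]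
      congr 1
      refine Finset.sum_congr rfl fun j _ => Finset.sum_congr rfl fun l _ => ?_
      rw [Sym2.eq_swap]
      ring⟩

theorem Family.gaussMean_apply (F : Family L n p) (x : Scale n p → ℂ) (D : ℂ) (α : Fin p → ℝ)
    (t u : Mom L n) : F.gaussMean x D α s(t, u) =
      ∑ j, ∑ l, (F.mean α t j : ℂ) * (F.mean α u l : ℂ) * x (Sum.inl s(j, l)) +
        Complex.I * D / 2 * (F.cov α t u : ℂ) := rfl

/-- External momenta do not fluctuate; this is the compatibility that `Family.Reduces.eval`
requires. -/
theorem Family.gaussMean_inr (F : Family L n p) (x : Scale n p → ℂ) (D : ℂ) (α : Fin p → ℝ)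
    (e : Sym2 (Fin n)) : F.gaussMean x D α (Sym2.map Sum.inr e) = x (Sum.inl e) := by
  induction e using Sym2.ind with
  | _ j l =>
    rw [Sym2.map_mk]
    rw [F.gaussMean_apply, Finset.sum_eq_single j, Finset.sum_eq_single l]
    · simp [Family.mean, Family.cov]
    · intro l' _ hl
      simp [Family.mean, Pi.single_eq_of_ne hl]
    · simp
    · intro j' _ hj
      simp [Family.mean, Pi.single_eq_of_ne hj]
    · simp

theorem Family.sum_coeff_mul_mean (F : Family L n p) (α : Fin p → ℝ) (b : Fin p) (j : Fin n) :
    ∑ t, (F.coeff b t : ℝ) * F.mean α t j =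
      (F.extVec b - Matrix.vecMul (F.loopVec b) ((F.loopMatrix α)⁻¹ * F.mixedMatrix α)) j := by
  rw [Fintype.sum_sum_type]
  simp only [Family.mean, Sum.elim_inl, Sum.elim_inr, Pi.sub_apply, Matrix.vecMul, dotProduct,
    Family.loopVec, Family.extVec, mul_neg, Finset.sum_neg_distrib, Pi.single_apply, mul_ite,
    mul_one, mul_zero, Finset.sum_ite_eq, Finset.mem_univ, if_true]
  ring

theorem sum_comm_four {ι κ : Type*} [Fintype ι] [Fintype κ] (f : ι → ι → κ → κ → ℂ) :
    ∑ t, ∑ u, ∑ j, ∑ l, f t u j l = ∑ j, ∑ l, ∑ t, ∑ u, f t u j l := by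
  have h1 : ∀ t, ∑ u, ∑ j, ∑ l, f t u j l = ∑ j, ∑ l, ∑ u, f t u j l := fun t => by
    rw [Finset.sum_comm]
    exact Finset.sum_congr rfl fun j _ => Finset.sum_comm
  simp only [h1]
  rw [Finset.sum_comm]
  exact Finset.sum_congr rfl fun j _ => Finset.sum_comm

theorem Family.invPropValue_gaussMean (F : Family L n p) (x : Scale n p → ℂ) (D : ℂ)
    (α : Fin p → ℝ) (b : Fin p) (m : Fin p → ℂ) :
    F.invPropValue (F.gaussMean x D α) m b = m b -
      ∑ j, ∑ l, (((F.extVec b - Matrix.vecMul (F.loopVec b) ((F.loopMatrix α)⁻¹ *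
        F.mixedMatrix α)) j : ℝ) : ℂ) * (((F.extVec b - Matrix.vecMul (F.loopVec b)
        ((F.loopMatrix α)⁻¹ * F.mixedMatrix α)) l : ℝ) : ℂ) * x (Sum.inl s(j, l)) -
      Complex.I * D / 2 *
        ((dotProduct (F.loopVec b) (Matrix.mulVec (F.loopMatrix α)⁻¹ (F.loopVec b)) : ℝ) : ℂ) := by
  have hcov : ∑ t, ∑ u, (F.coeff b t : ℝ) * (F.coeff b u : ℝ) * F.cov α t u =
      dotProduct (F.loopVec b) (Matrix.mulVec (F.loopMatrix α)⁻¹ (F.loopVec b)) := by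
    simp only [Fintype.sum_sum_type, Family.cov, Sum.elim_inl, Sum.elim_inr, mul_zero,
      Finset.sum_const_zero, add_zero, dotProduct, Matrix.mulVec, Family.loopVec, Finset.mul_sum]
    refine Finset.sum_congr rfl fun i _ => Finset.sum_congr rfl fun j _ => by ring
  rw [Family.invPropValue, sub_sub, ← hcov]
  congr 1
  simp only [F.gaussMean_apply, mul_add, Finset.sum_add_distrib]
  congr 1
  · simp only [← F.sum_coeff_mul_mean]
    push_cast
    simp only [Finset.sum_mul, Finset.mul_sum]
    rw [sum_comm_four]
    exact Finset.sum_congr rfl fun j _ => Finset.sum_congr rfl fun l _ =>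
      (Finset.sum_comm).trans (Finset.sum_congr rfl fun t _ => Finset.sum_congr rfl fun u _ =>
        by ring)
  · push_cast
    simp only [Finset.mul_sum]
    exact Finset.sum_congr rfl fun t _ => Finset.sum_congr rfl fun u _ => by ring

/-- Along `α_b = s`, with increment `c = s - α b`, `U` scales by `1 + c κ` and `F / U` changes by `c
m_b ^ 2 - c Q / (1 + c κ)`. The logarithmic derivative at `c = 0`, times `i`, is `m_b ^ 2 - Q - i D
κ / 2`, which is the inverse propagator at the Gaussian expectation values. -/
theorem Family.insertProp_gaussian (F : Family L n p) (x : Scale n p → ℂ) (D : ℂ)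
    {α : Fin p → ℝ} (hU : 0 < F.symanzikU α) (b : Fin p) :
    insertProp b (F.gaussian x D) α = F.gaussian x D α *
      F.invPropValue (F.gaussMean x D α) (fun a => x (Sum.inr a)) b := by
  rw [F.invPropValue_gaussMean]
  set w := F.extVec b - Matrix.vecMul (F.loopVec b) ((F.loopMatrix α)⁻¹ * F.mixedMatrix α) with hw
  set κ := dotProduct (F.loopVec b) (Matrix.mulVec (F.loopMatrix α)⁻¹ (F.loopVec b)) with hκ
  set Q : ℂ := ∑ j, ∑ l, (w j : ℂ) * (w l : ℂ) * x (Sum.inl s(j, l)) with hQ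
  set S : ℂ := F.symanzikF x α / F.symanzikU α with hS
  have hev : ∀ᶠ s : ℝ in 𝓝 (α b), 0 < 1 + (s - α b) * κ := by
    have : ContinuousAt (fun s : ℝ => 1 + (s - α b) * κ) (α b) := by fun_prop
    exact this.eventually (lt_mem_nhds (by simp))
  have hUs : ∀ s, F.symanzikU (Function.update α b s) = F.symanzikU α * (1 + (s - α b) * κ) := by
    intro s
    rw [Family.symanzikU, F.loopMatrix_update, det_add_smul_vecMulVec hU.ne']
    rfl
  have hG : (fun s => F.gaussian x D (Function.update α b s)) =ᶠ[𝓝 (α b)] fun s : ℝ =>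
      ((F.symanzikU α : ℂ) * (1 + ((s : ℂ) - α b) * κ)) ^ (-D / 2) *
        Complex.exp (-Complex.I * (S + ((s : ℂ) - α b) * x (Sum.inr b) -
          ((s : ℂ) - α b) / (1 + ((s : ℂ) - α b) * κ) * Q)) := by
    filter_upwards [hev] with s hs
    have hpos : 0 < F.symanzikU (Function.update α b s) := by
      rw [hUs]; exact mul_pos hU hs
    rw [Family.gaussian, if_pos hpos, mul_div_assoc, F.symanzikF_div x hpos.ne', hS,
      F.symanzikF_div x hU.ne', hUs]
    have hm : ∑ a, x (Sum.inr a) * ((Function.update α b s a : ℝ) : ℂ) =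
        ∑ a, x (Sum.inr a) * (α a : ℂ) + ((s : ℂ) - α b) * x (Sum.inr b) := by
      rw [← Finset.add_sum_erase _ _ (Finset.mem_univ b),
        ← Finset.add_sum_erase _ (fun a => x (Sum.inr a) * (α a : ℂ)) (Finset.mem_univ b)]
      have : ∑ a ∈ Finset.univ.erase b, x (Sum.inr a) * ((Function.update α b s a : ℝ) : ℂ) =
          ∑ a ∈ Finset.univ.erase b, x (Sum.inr a) * (α a : ℂ) :=
        Finset.sum_congr rfl fun a ha => by rw [Function.update_of_ne (Finset.ne_of_mem_erase ha)]
      rw [this, Function.update_self]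
      ring
    rw [hm, F.loopMatrix_update, F.mixedMatrix_update, F.extMatrix_update,
      schur_add_smul_vecMulVec hU.ne' (F.loopMatrix_transpose α) _ _ hs.ne', ← hw, ← hκ]
    congr 2
    · push_cast; rfl
    · simp only [Matrix.add_apply, Matrix.smul_apply, Matrix.vecMulVec_apply, smul_eq_mul, hQ]
      push_cast
      simp only [add_mul, Finset.sum_add_distrib, Finset.mul_sum, mul_assoc]
      ring
  have hs1 : HasDerivAt (fun s : ℝ => (s : ℂ) - α b) 1 (α b) :=
    ((hasDerivAt_id (α b)).ofReal_comp).sub_const _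
  have hc : HasDerivAt (fun s : ℝ => 1 + ((s : ℂ) - α b) * κ) κ (α b) := by
    simpa using (hs1.mul_const (κ : ℂ)).const_add 1
  have hslit : ((F.symanzikU α : ℂ) * (1 + (((α b : ℝ) : ℂ) - α b) * κ)) ∈ Complex.slitPlane := by
    rw [sub_self, zero_mul, add_zero, mul_one]
    exact Or.inl (by simpa using hU)
  have hpow := (Complex.hasStrictDerivAt_cpow_const (c := -D / 2) hslit).hasDerivAt.comp (α b)
    (hc.const_mul (F.symanzikU α : ℂ))
  have hne : (1 + (((α b : ℝ) : ℂ) - α b) * κ) ≠ 0 := by simp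
  have hexp := (((((hs1.mul_const (x (Sum.inr b))).const_add S).fun_sub
    ((hs1.fun_div hc hne).mul_const Q))).const_mul (-Complex.I)).cexp
  have hall := (hpow.fun_mul hexp).congr_of_eventuallyEq hG
  have hUne : (F.symanzikU α : ℂ) ≠ 0 := by exact_mod_cast hU.ne'
  rw [insertProp, hall.deriv, Family.gaussian, if_pos hU, mul_div_assoc, ← hS]
  simp only [Function.comp_apply, sub_self, zero_mul, add_zero, mul_one, zero_div, sub_zero, one_mul]
  rw [Complex.cpow_sub _ _ hUne, Complex.cpow_one]
  field_simp
  ring_nf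
  simp only [Complex.I_sq]
  ring

/-! ### The relation for convergent integrals -/

/-- The row of `k_i` in the matrix of `∑ a, α_a q_a ^ 2`. -/
def Family.row (F : Family L n p) (α : Fin p → ℝ) (i : Fin L) (u : Mom L n) : ℝ :=
  ∑ a, α a * (F.coeff a (Sum.inl i) * F.coeff a u)

theorem Family.sum_row_mul_mean (F : Family L n p) {α : Fin p → ℝ} (hU : F.symanzikU α ≠ 0)
    (i : Fin L) (l : Fin n) : ∑ u, F.row α i u * F.mean α u l = 0 := by
  have h1 : F.loopMatrix α * ((F.loopMatrix α)⁻¹ * F.mixedMatrix α) = F.mixedMatrix α :=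
    Matrix.mul_nonsing_inv_cancel_left _ _ (isUnit_iff_ne_zero.2 hU)
  have h2 := congrFun (congrFun h1 i) l
  rw [Matrix.mul_apply] at h2
  rw [Fintype.sum_sum_type]
  simp only [Family.mean, Sum.elim_inl, Sum.elim_inr, mul_neg, Finset.sum_neg_distrib,
    Pi.single_apply, mul_ite, mul_one, mul_zero, Finset.sum_ite_eq, Finset.mem_univ, if_true]
  exact neg_add_eq_zero.2 h2

theorem Family.sum_row_mul_cov (F : Family L n p) {α : Fin p → ℝ} (hU : F.symanzikU α ≠ 0)
    (i : Fin L) (t : Mom L n) :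
    ∑ u, F.row α i u * F.cov α t u = if t = Sum.inl i then 1 else 0 := by
  rw [Fintype.sum_sum_type]
  rcases t with i' | j
  · have h1 := congrFun (congrFun (Matrix.mul_nonsing_inv (F.loopMatrix α)
      (isUnit_iff_ne_zero.2 hU)) i) i'
    rw [Matrix.mul_apply, Matrix.one_apply] at h1
    simp only [Family.cov, Sum.elim_inl, Sum.elim_inr, mul_zero, Finset.sum_const_zero, add_zero,
      F.loopMatrix_inv_symm α i', Sum.inl.injEq]
    simp only [eq_comm (a := i')]
    exact h1
  · simp [Family.cov]

/-- Integration by parts for a Gaussian: row `i` of the quadratic form annihilates the mean by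
stationarity, and pairs with the covariance to the identity because `A A⁻¹ = 1`. -/
theorem Family.sum_param_mul_gaussMean (F : Family L n p) (x : Scale n p → ℂ) (D : ℂ)
    {α : Fin p → ℝ} (hU : F.symanzikU α ≠ 0) (i : Fin L) (t : Mom L n) :
    ∑ a, ∑ u, (α a : ℂ) * ((F.coeff a (Sum.inl i) : ℂ) * (F.coeff a u : ℂ)) *
      F.gaussMean x D α s(t, u) = if t = Sum.inl i then Complex.I * D / 2 else 0 := by
  have h1 : ∀ l, ∑ u, (F.row α i u : ℂ) * (F.mean α u l : ℂ) = 0 := fun l => by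
    exact_mod_cast congrArg (fun r : ℝ => (r : ℂ)) (F.sum_row_mul_mean hU i l)
  have h2 : ∑ u, (F.row α i u : ℂ) * (F.cov α t u : ℂ) = if t = Sum.inl i then 1 else 0 := by
    have := congrArg (fun r : ℝ => (r : ℂ)) (F.sum_row_mul_cov hU i t)
    push_cast at this
    rw [this]
    split_ifs <;> simp
  calc _ = ∑ u, (F.row α i u : ℂ) * F.gaussMean x D α s(t, u) := by
        rw [Finset.sum_comm]
        refine Finset.sum_congr rfl fun u _ => ?_
        rw [Family.row]
        push_cast
        rw [Finset.sum_mul]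
    _ = ∑ j, ∑ l, (F.mean α t j : ℂ) * x (Sum.inl s(j, l)) *
          (∑ u, (F.row α i u : ℂ) * (F.mean α u l : ℂ)) +
        Complex.I * D / 2 * ∑ u, (F.row α i u : ℂ) * (F.cov α t u : ℂ) := by
        simp only [F.gaussMean_apply, mul_add, Finset.sum_add_distrib, Finset.mul_sum]
        congr 1
        · rw [Finset.sum_comm]
          refine Finset.sum_congr rfl fun j _ => ?_
          rw [Finset.sum_comm]
          exact Finset.sum_congr rfl fun l _ => Finset.sum_congr rfl fun u _ => by ring
        · exact Finset.sum_congr rfl fun u _ => by ring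
    _ = _ := by
        simp only [h1, h2, mul_zero, Finset.sum_const_zero, zero_add]
        split_ifs <;> simp

/-- The polynomial whose Gaussian function vanishes, and whose Schwinger functional is the
left-hand side of the recursion relation. -/
def Family.ibpPoly (F : Family L n p) (l : Mom L n → Mom L n → Fin p → MvPolynomial (Scale n p) ℚ)
    (r : Mom L n → Mom L n → MvPolynomial (Scale n p) ℚ) (x : Scale n p → ℂ) (D : ℂ) (i : Fin L)
    (t : Mom L n) : MvPolynomial (Fin p) ℂ :=
  (if t = Sum.inl i then D else 0) • F.polyU ^ 2 +
    ∑ a, ∑ u, (2 * (F.coeff a (Sum.inl i) : ℂ) * (F.coeff a u : ℂ) * Complex.I) •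
      (∑ b, MvPolynomial.aeval x (l t u b) •
        (MvPolynomial.X a * insOp F.polyU (F.polyF x) b (-D / 2) 1) +
        MvPolynomial.aeval x (r t u) • (MvPolynomial.X a * F.polyU ^ 2))

/-- The recursion relation before integration. Completeness at the Gaussian expectation values
recombines the insertions into `⟨t · u⟩`; the sum over `a`, `u` is `i D / 2` for `t = k_i`, and `2 i
* (i D / 2) = -D` cancels the dimension term. -/
theorem Family.Reduces.expFun_ibpPoly {F : Family L n p} {l r} (h : F.Reduces l r)
    (x : Scale n p → ℂ) {δ : ℝ} (hd : IsDamped F.polyU (F.polyF x) δ) {D : ℂ}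
    (hD : 1 < (-D / 2).re) (i : Fin L) (t : Mom L n) :
    expFun F.polyU (F.polyF x) (-D / 2 - 2) (F.ibpPoly l r x D i t) = 0 := by
  funext α
  rw [Pi.zero_apply]
  by_cases hu : 0 < (ev α F.polyU).re
  swap
  · rw [expFun, if_neg hu]
  have hU : 0 < F.symanzikU α := by rwa [F.ev_polyU, Complex.ofReal_re] at hu
  have hG : ev α (F.polyU ^ 2) * (ev α F.polyU ^ (-D / 2 - 2) *
      Complex.exp (-Complex.I * ev α (F.polyF x) / ev α F.polyU)) = F.gaussian x D α := by
    rw [F.gaussian_eq_expFun, ← expFun_sub_two, expFun, if_pos hu, mul_one]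
  have hT : ∀ b, ev α (insOp F.polyU (F.polyF x) b (-D / 2) 1) * (ev α F.polyU ^ (-D / 2 - 2) *
      Complex.exp (-Complex.I * ev α (F.polyF x) / ev α F.polyU)) = F.gaussian x D α *
        F.invPropValue (F.gaussMean x D α) (fun a => x (Sum.inr a)) b := by
    intro b
    rw [← F.insertProp_gaussian x D hU, F.gaussian_eq_expFun, hd.insertProp_expFun hD, expFun,
      if_pos hu]
  rw [expFun, if_pos hu]
  set E := ev α F.polyU ^ (-D / 2 - 2) *
      Complex.exp (-Complex.I * ev α (F.polyF x) / ev α F.polyU) with hE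
  have hsum : ev α (F.ibpPoly l r x D i t) * E =
      F.gaussian x D α * ((if t = Sum.inl i then D else 0) + 2 * Complex.I *
        ∑ a, ∑ u, (α a : ℂ) * ((F.coeff a (Sum.inl i) : ℂ) * (F.coeff a u : ℂ)) *
          F.gaussMean x D α s(t, u)) := by
    simp only [Family.ibpPoly, MvPolynomial.smul_eq_C_mul, map_add, map_sum, map_mul, ev_C, ev_X]
    rw [add_mul, mul_add, mul_assoc, hG]
    congr 1
    · ring
    · simp only [Finset.sum_mul, Finset.mul_sum]
      refine Finset.sum_congr rfl fun a _ => Finset.sum_congr rfl fun u _ => ?_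
      rw [h.eval (F.gaussMean x D α) x (F.gaussMean_inr x D α) t u]
      have h1 : (∑ b, MvPolynomial.aeval x (l t u b) *
          ((α a : ℂ) * ev α (insOp F.polyU (F.polyF x) b (-D / 2) 1))) * E =
          F.gaussian x D α * (α a : ℂ) * ∑ b, MvPolynomial.aeval x (l t u b) *
            F.invPropValue (F.gaussMean x D α) (fun a => x (Sum.inr a)) b := by
        rw [Finset.sum_mul, Finset.mul_sum]
        refine Finset.sum_congr rfl fun b _ => ?_
        linear_combination MvPolynomial.aeval x (l t u b) * (α a : ℂ) * hT b
      linear_combination (2 * (F.coeff a (Sum.inl i) : ℂ) * (F.coeff a u : ℂ) * Complex.I) * h1 +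
        (2 * (F.coeff a (Sum.inl i) : ℂ) * (F.coeff a u : ℂ) * Complex.I) *
          MvPolynomial.aeval x (r t u) * (α a : ℂ) * hG
  rw [hsum, F.sum_param_mul_gaussMean x D hU.ne']
  split_ifs
  · linear_combination F.gaussian x D α * D * Complex.I_mul_I
  · simp

theorem Family.Reduces.sum_schwingerFunctional {F : Family L n p} {l r} (h : F.Reduces l r)
    (D₀ : ℕ) (i : Fin L) (t : Mom L n) (x : Scale n p → ℂ) {δ : ℝ} (hδ : 0 < δ)
    (hd : IsDamped F.polyU (F.polyF x) δ) (ν : Fin p → ℤ) {ε : ℂ}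
    -- Each derivative costs `2` in the real part of the power of `U`; the `10` is slack for the few
    -- derivatives beyond `order ν`.
    (hε : (D₀ : ℝ) / 2 + 2 * ((order ν : ℝ) + 10) < ε.re) :
    ((F.ibpCoeff l r D₀ i t).sum fun s b => Coeff.eval b x ν ε *
      schwingerFunctional (ν + s) (F.gaussian x (D₀ - 2 * ε))) = 0 := by
  rw [F.sum_ibpCoeff l r D₀ i t x ν ε
    (fun s => schwingerFunctional (ν + s) (F.gaussian x (D₀ - 2 * ε)))]
  set D : ℂ := D₀ - 2 * ε with hD
  have hz : (-D / 2).re = ε.re - D₀ / 2 := by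
    have : -D / 2 = ε - ((D₀ / 2 : ℝ) : ℂ) := by rw [hD]; push_cast; ring
    rw [this, Complex.sub_re, Complex.ofReal_re]
  have hord : (0 : ℝ) ≤ order ν := Nat.cast_nonneg _
  have hz1 : 1 < (-D / 2).re := by rw [hz]; linarith
  have hN : ∀ P, Nice F.polyU (F.polyF x) (order ν + 10) (expFun F.polyU (F.polyF x) (-D / 2) P) :=
    fun P => ⟨_, P, by push_cast; rw [hz]; linarith, rfl⟩
  obtain ⟨Φ, hΦ⟩ := exists_schwingerFunctional_eq hδ hd ν (z := -D / 2 - 2) (by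
    rw [Complex.sub_re, Complex.re_ofNat, hz]; linarith)
  have hG := F.gaussian_eq_expFun x D
  have hGn : Nice F.polyU (F.polyF x) (order ν + 10) (F.gaussian x D) := hG ▸ hN 1
  have e0 : schwingerFunctional ν (F.gaussian x D) = Φ (F.polyU ^ 2) := by
    rw [hG, ← expFun_sub_two, hΦ, mul_one]
  have e1 : ∀ a, (ν a : ℂ) * schwingerFunctional (ν + Pi.single a 1) (F.gaussian x D) =
      Complex.I * Φ (MvPolynomial.X a * F.polyU ^ 2) := by
    intro a
    have h1 := schwingerFunctional_mulParam hδ hd a _ (ν := ν) rfl (hGn.mono (by omega))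
    have h2 : schwingerFunctional ν (mulParam a (F.gaussian x D)) =
        Φ (MvPolynomial.X a * F.polyU ^ 2) := by
      rw [hG, mulParam_expFun, ← expFun_sub_two, hΦ]
      congr 1
      ring
    rw [← h2, h1]
    linear_combination ((ν a : ℂ) *
      schwingerFunctional (ν + Pi.single a 1) (F.gaussian x D)) * Complex.I_mul_I
  -- The factor `ν a` belongs to `ν` itself, so `α_a` multiplies outside the derivative: first `b`
  -- is lowered starting from `ν + e_a`, and then `e_a` is traded for `α_a`.
  have e2 : ∀ a b, (ν a : ℂ) *
      schwingerFunctional (ν + (Pi.single a 1 - Pi.single b 1)) (F.gaussian x D) =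
      Complex.I * Φ (MvPolynomial.X a * insOp F.polyU (F.polyF x) b (-D / 2) 1) := by
    intro a b
    have hle := order_add_single_le ν a
    have h0 := schwingerFunctional_insertProp hδ hd (ν := ν + Pi.single a 1) b
      (hGn.mono (by omega))
    rw [← add_sub_assoc, ← h0]
    have h1 := schwingerFunctional_mulParam hδ hd a _ (ν := ν) rfl
      (f := insertProp b (F.gaussian x D))
      ((hGn.mono (by omega) : Nice F.polyU (F.polyF x) (3 + order ν + 1) _).insertProp hd b)
    have h2 : schwingerFunctional ν (mulParam a (insertProp b (F.gaussian x D))) =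
        Φ (MvPolynomial.X a * insOp F.polyU (F.polyF x) b (-D / 2) 1) := by
      rw [hG, hd.insertProp_expFun hz1, mulParam_expFun, hΦ]
    rw [← h2, h1]
    linear_combination ((ν a : ℂ) *
      schwingerFunctional (ν + Pi.single a 1) (insertProp b (F.gaussian x D))) * Complex.I_mul_I
  have e3 : Φ (F.ibpPoly l r x D i t) = 0 := by
    rw [← hΦ, h.expFun_ibpPoly x hd hz1]
    have h0 : expFun F.polyU (F.polyF x) (-D / 2 - 2) 0 = 0 := by
      funext α; simp [expFun]
    rw [← h0, hΦ, map_zero]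
  refine Eq.trans ?_ e3
  rw [Family.ibpPoly, add_zero, e0]
  simp only [map_add, map_sum, map_smul, smul_eq_mul]
  congr 1
  · split_ifs <;> simp
  · refine Finset.sum_congr rfl fun a _ => Finset.sum_congr rfl fun u _ => ?_
    have h1 : (ν a : ℂ) * ∑ b, MvPolynomial.aeval x (l t u b) *
        schwingerFunctional (ν + (Pi.single a 1 - Pi.single b 1)) (F.gaussian x D) =
        Complex.I * ∑ b, MvPolynomial.aeval x (l t u b) *
          Φ (MvPolynomial.X a * insOp F.polyU (F.polyF x) b (-D / 2) 1) := by
      rw [Finset.mul_sum, Finset.mul_sum]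
      refine Finset.sum_congr rfl fun b _ => ?_
      linear_combination MvPolynomial.aeval x (l t u b) * e2 a b
    linear_combination (2 * (F.coeff a (Sum.inl i) : ℂ) * (F.coeff a u : ℂ)) * h1 +
      (2 * (F.coeff a (Sum.inl i) : ℂ) * (F.coeff a u : ℂ)) *
        MvPolynomial.aeval x (r t u) * e1 a

theorem Family.Reduces.schwinger_relation {F : Family L n p} {l r} (h : F.Reduces l r)
    (D₀ : ℕ) (i : Fin L) (t : Mom L n) (x : Scale n p → ℝ) (ν : Fin p → ℤ) {δ : ℝ} (hδ : 0 < δ) :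
    ∃ R : ℝ, ∀ ε : ℂ, R < ε.re →
      (∀ s ∈ (F.ibpCoeff l r D₀ i t).support, IntegrableOn
        (F.schwingerIntegrand (shiftScales x δ) (ν + s) (D₀ - 2 * ε)) (orthant (ν + s))) ∧
      ((F.ibpCoeff l r D₀ i t).sum fun s b => Coeff.eval b (shiftScales x δ) ν ε *
        F.schwinger D₀ (shiftScales x δ) (ν + s) ε) = 0 := by
  set c := F.ibpCoeff l r D₀ i t with hc
  have hd := F.isDamped x δ
  -- The sum dominates the order of every shifted exponent that occurs, so one bound gives
  -- convergence of all the integrals.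
  refine ⟨D₀ / 2 + 2 * ((order ν : ℝ) + 10) + 2 * ∑ s ∈ c.support, (order (ν + s) : ℝ),
    fun ε hε => ?_⟩
  have h0 : (0 : ℝ) ≤ ∑ s ∈ c.support, (order (ν + s) : ℝ) :=
    Finset.sum_nonneg fun s _ => Nat.cast_nonneg _
  have key : ∀ s ∈ c.support, IntegrableOn
      (F.schwingerIntegrand (shiftScales x δ) (ν + s) (D₀ - 2 * ε)) (orthant (ν + s)) ∧
      ∫ α in orthant (ν + s), F.schwingerIntegrand (shiftScales x δ) (ν + s) (D₀ - 2 * ε) α =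
        schwingerFunctional (ν + s) (F.gaussian (shiftScales x δ) (D₀ - 2 * ε)) := by
    intro s hs
    refine schwingerIntegrand_integrable_and_integral F _ (ν + s) _ hδ hd (N := 0) ?_
    rw [F.gaussian_eq_expFun]
    refine ⟨_, 1, ?_, rfl⟩
    have h1 : (order (ν + s) : ℝ) ≤ ∑ s ∈ c.support, (order (ν + s) : ℝ) :=
      Finset.single_le_sum (f := fun s => (order (ν + s) : ℝ)) (fun s _ => Nat.cast_nonneg _) hs
    have h2 : -((D₀ : ℂ) - 2 * ε) / 2 = ε - ((D₀ / 2 : ℝ) : ℂ) := by push_cast; ring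
    have h3 : (0 : ℝ) ≤ order ν := Nat.cast_nonneg _
    rw [h2, Complex.sub_re, Complex.ofReal_re, zero_add]
    linarith
  refine ⟨fun s hs => (key s hs).1, ?_⟩
  have h1 := h.sum_schwingerFunctional D₀ i t (shiftScales x δ) hδ hd ν (ε := ε) (by linarith)
  rw [← hc] at h1
  have h2 : (c.sum fun s b => Coeff.eval b (shiftScales x δ) ν ε *
      F.schwinger D₀ (shiftScales x δ) (ν + s) ε) =
      Complex.exp (Real.eulerMascheroniConstant * L * ε) *
        Complex.I ^ (-(L : ℂ) * (D₀ - 2 * ε) / 2) *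
        c.sum fun s b => Coeff.eval b (shiftScales x δ) ν ε *
          schwingerFunctional (ν + s) (F.gaussian (shiftScales x δ) (D₀ - 2 * ε)) := by
    rw [Finsupp.mul_sum]
    refine Finset.sum_congr rfl fun s hs => ?_
    beta_reduce
    rw [Family.schwinger, (key s hs).2]
    ring
  rw [h2, h1, mul_zero]

/-! ### Meromorphic continuation -/

/-- Infinite meromorphic order propagates over the connected plane. This yields vanishing only on a
punctured neighbourhood of `z`; continuity there gives the value at `z`. -/
theorem eqOn_zero_of_meromorphicOn {f : ℂ → ℂ} (hf : MeromorphicOn f Set.univ) {z₀ : ℂ}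
    (h0 : ∀ᶠ z in 𝓝 z₀, f z = 0) {z : ℂ} (hz : AnalyticAt ℂ f z) : f z = 0 := by
  by_contra hne
  have h1 : meromorphicOrderAt f z ≠ ⊤ := by
    rw [Ne, meromorphicOrderAt_eq_top_iff]
    intro h2
    have h3 : Filter.Tendsto f (𝓝[≠] z) (𝓝 (f z)) :=
      hz.continuousAt.tendsto.mono_left nhdsWithin_le_nhds
    have h4 : Filter.Tendsto f (𝓝[≠] z) (𝓝 0) :=
      tendsto_const_nhds.congr' (h2.mono fun w hw => hw.symm)
    exact hne (tendsto_nhds_unique h3 h4)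
  have h5 := hf.meromorphicOrderAt_ne_top_of_isPreconnected isPreconnected_univ
    (Set.mem_univ z) (Set.mem_univ z₀) h1
  exact h5 (meromorphicOrderAt_eq_top_iff.2 (h0.filter_mono nhdsWithin_le_nhds))

theorem Coeff.analyticAt_eval (b : Coeff n p) (x : Scale n p → ℂ) (ν : Fin p → ℤ) (ε : ℂ) :
    AnalyticAt ℂ (fun ε => Coeff.eval b x ν ε) ε := by
  unfold Coeff.eval
  induction b using MvPolynomial.induction_on with
  | C c => simpa using analyticAt_const
  | add P Q hP hQ => simpa using hP.fun_add hQ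
  | mul_X P e hP =>
    simp only [map_mul, MvPolynomial.aeval_X]
    refine hP.fun_mul ?_
    rcases e with e | e | e
    · exact analyticAt_const
    · exact analyticAt_const
    · exact analyticAt_id

theorem Coeff.continuous_eval (b : Coeff n p) (x : Scale n p → ℝ) (ν : Fin p → ℤ) (ε : ℂ) :
    Continuous fun δ : ℝ => Coeff.eval b (shiftScales x δ) ν ε := by
  unfold Coeff.eval
  induction b using MvPolynomial.induction_on with
  | C c => simpa using continuous_const
  | add P Q hP hQ => simpa using hP.fun_add hQ
  | mul_X P e hP =>
    simp only [map_mul, MvPolynomial.aeval_X]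
    refine hP.mul ?_
    rcases e with (e | e) | e | e
    · exact continuous_const
    · simp only [Sum.elim_inl, shiftScales, Sum.elim_inr]; fun_prop
    · exact continuous_const
    · exact continuous_const

theorem shiftScales_zero (x : Scale n p → ℝ) : shiftScales x 0 = fun e => (x e : ℂ) := by
  funext e
  rcases e with e | e <;> simp [shiftScales]

/-- A relation between Schwinger parametrisations extends to the dimensionally regularised
integrals. -/
theorem Family.relation_of_isFeynmanIntegral (F : Family L n p) (D₀ : ℕ)
    (c : (Fin p → ℤ) →₀ Coeff n p) (x : Scale n p → ℝ) (ν : Fin p → ℤ)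
    (hrel : ∀ δ : ℝ, 0 < δ → ∃ R : ℝ, ∀ ε : ℂ, R < ε.re →
      (c.sum fun s b => Coeff.eval b (shiftScales x δ) ν ε *
        F.schwinger D₀ (shiftScales x δ) (ν + s) ε) = 0)
    (I : (Fin p → ℤ) → ℂ → ℂ)
    (hI : ∀ s ∈ c.support, F.IsFeynmanIntegral D₀ x (ν + s) (I (ν + s))) (ε : ℂ)
    (hε : ∀ s ∈ c.support, AnalyticAt ℂ (I (ν + s)) ε) :
    (c.sum fun s b => Coeff.eval b (fun e => (x e : ℂ)) ν ε * I (ν + s) ε) = 0 := by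
  choose! hmer J hJ R hR using hI
  have hmero : ∀ (y : Scale n p → ℂ) (g : (Fin p → ℤ) → ℂ → ℂ),
      (∀ s ∈ c.support, MeromorphicOn (g s) Set.univ) →
      MeromorphicOn (fun ε => c.sum fun s b => Coeff.eval b y ν ε * g s ε) Set.univ := by
    intro y g hg z hz
    exact MeromorphicAt.fun_sum fun s hs =>
      ((c s).analyticAt_eval y ν z).meromorphicAt.fun_mul (hg s hs z hz)
  have hana : ∀ (y : Scale n p → ℂ) (g : (Fin p → ℤ) → ℂ → ℂ) (z : ℂ),
      (∀ s ∈ c.support, AnalyticAt ℂ (g s) z) →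
      AnalyticAt ℂ (fun ε => c.sum fun s b => Coeff.eval b y ν ε * g s ε) z := by
    intro y g z hg
    exact Finset.analyticAt_fun_sum _ fun s hs =>
      ((c s).analyticAt_eval y ν z).fun_mul (hg s hs)
  -- First continuation, at fixed `δ`: near the real point `M + 1` every `J s δ` is the convergent
  -- parametrisation, for which the relation is known.
  have hJzero : ∀ δ : ℝ, 0 < δ → ∀ z : ℂ, (∀ s ∈ c.support, AnalyticAt ℂ (J s δ) z) →
      (c.sum fun s b => Coeff.eval b (shiftScales x δ) ν z * J s δ z) = 0 := by
    intro δ hδ z hz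
    obtain ⟨R₀, hR₀⟩ := hrel δ hδ
    have hJ' := fun s hs => (hJ s hs δ hδ).2
    choose! R' hR' using hJ'
    set M : ℝ := |R₀| + ∑ s ∈ c.support, |R' s| with hM
    refine eqOn_zero_of_meromorphicOn (f := fun ε => c.sum fun s b =>
      Coeff.eval b (shiftScales x δ) ν ε * J s δ ε) (hmero _ _ fun s hs => (hJ s hs δ hδ).1)
      (z₀ := ((M + 1 : ℝ) : ℂ)) ?_ (hana _ _ z hz)
    have hopen : ∀ᶠ w : ℂ in 𝓝 ((M + 1 : ℝ) : ℂ), M < w.re :=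
      Complex.continuous_re.continuousAt.eventually (lt_mem_nhds (by simp))
    filter_upwards [hopen] with w hw
    have hs0 : 0 ≤ ∑ s ∈ c.support, |R' s| := Finset.sum_nonneg fun s _ => abs_nonneg _
    rw [← hR₀ w (by linarith [le_abs_self R₀])]
    refine Finset.sum_congr rfl fun s hs => ?_
    have h1 : |R' s| ≤ ∑ s ∈ c.support, |R' s| :=
      Finset.single_le_sum (f := fun s => |R' s|) (fun s _ => abs_nonneg _) hs
    beta_reduce
    rw [hR' s hs w (by linarith [le_abs_self (R' s), abs_nonneg R₀])]
  set M : ℝ := ∑ s ∈ c.support, |R s| with hM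
  -- Second continuation, now for the limit `δ → 0+`. The base point is far to the left and has
  -- imaginary part `1`, because the limit is only given off the real axis.
  refine eqOn_zero_of_meromorphicOn (f := fun ε => c.sum fun s b =>
    Coeff.eval b (fun e => (x e : ℂ)) ν ε * I (ν + s) ε) (hmero _ _ hmer)
    (z₀ := ((-M - 1 : ℝ) : ℂ) + Complex.I) ?_ (hana _ _ ε hε)
  have hopen : ∀ᶠ w : ℂ in 𝓝 (((-M - 1 : ℝ) : ℂ) + Complex.I), w.re < -M :=
    Complex.continuous_re.continuousAt.eventually (gt_mem_nhds (by simp))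
  have hopen' : ∀ᶠ w : ℂ in 𝓝 (((-M - 1 : ℝ) : ℂ) + Complex.I), 0 < w.im :=
    Complex.continuous_im.continuousAt.eventually (lt_mem_nhds (by simp))
  filter_upwards [hopen, hopen'] with w hw hw'
  have hRs : ∀ s ∈ c.support, w.re < R s := by
    intro s hs
    have h1 : |R s| ≤ M := Finset.single_le_sum (f := fun s => |R s|) (fun s _ => abs_nonneg _) hs
    linarith [neg_abs_le (R s)]
  have hlim : Filter.Tendsto (fun δ => c.sum fun s b =>
      Coeff.eval b (shiftScales x δ) ν w * J s δ w) (𝓝[>] (0 : ℝ))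
      (𝓝 (c.sum fun s b => Coeff.eval b (fun e => (x e : ℂ)) ν w * I (ν + s) w)) := by
    refine tendsto_finsetSum _ fun s hs => ?_
    refine Filter.Tendsto.mul ?_ (hR s hs w (hRs s hs) hw'.ne').2
    have := ((c s).continuous_eval x ν w).tendsto 0
    rw [shiftScales_zero] at this
    exact this.mono_left nhdsWithin_le_nhds
  have hzero : ∀ᶠ δ in 𝓝[>] (0 : ℝ), (c.sum fun s b =>
      Coeff.eval b (shiftScales x δ) ν w * J s δ w) = 0 := by
    have h1 : ∀ᶠ δ in 𝓝[>] (0 : ℝ), ∀ s ∈ c.support, AnalyticAt ℂ (J s δ) w :=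
      (Filter.eventually_all_finset _).2 fun s hs => (hR s hs w (hRs s hs) hw'.ne').1
    filter_upwards [h1, self_mem_nhdsWithin] with δ h2 hδ
    exact hJzero δ hδ w h2
  exact tendsto_nhds_unique (hlim.congr' hzero) tendsto_const_nhds

end

end Feynman

theorem mainTheorem4 {L n p : ℕ} (F : Feynman.Family L n p) (hF : F.IsComplete) (D₀ : ℕ)
    (i : Fin L) (t : Feynman.Mom L n) :
    ∃ c : (Fin p → ℤ) →₀ Feynman.Coeff n p, c ≠ 0 ∧
      -- the total derivative with respect to `k_i`, in direction of the momentum `t`, of every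
      -- integrand is a combination of integrands with shifted exponents, in every dimension `d`
      (∀ (d : ℕ) (P : Fin n → Fin d → ℝ) (m2 : Fin p → ℝ), (∀ a, 0 ≤ m2 a) →
        ∀ (δ : ℝ), 0 < δ → ∀ (ν : Fin p → ℤ) (k : Fin L → Fin d → ℝ),
          Feynman.totalDerivative P i t (F.integrand P m2 δ ν) k =
            c.sum fun s b =>
              Feynman.Coeff.eval b (Feynman.shiftScales (Feynman.scalesOf P m2) δ) ν
                (((D₀ : ℂ) - d) / 2) * F.integrand P m2 δ (ν + s) k) ∧
      ∀ x : Feynman.Scale n p → ℝ, (∀ a, 0 ≤ x (Sum.inr a)) → ∀ ν : Fin p → ℤ,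
        -- the corresponding relation, for convergent integrals
        (∀ δ : ℝ, 0 < δ → ∃ R : ℝ, ∀ ε : ℂ, R < ε.re →
          (∀ s ∈ c.support, MeasureTheory.IntegrableOn
            (F.schwingerIntegrand (Feynman.shiftScales x δ) (ν + s) (D₀ - 2 * ε))
            (Feynman.orthant (ν + s))) ∧
          (c.sum fun s b => Feynman.Coeff.eval b (Feynman.shiftScales x δ) ν ε *
            F.schwinger D₀ (Feynman.shiftScales x δ) (ν + s) ε) = 0) ∧
        -- the corresponding relation, for dimensionally regularised integrals
        (∀ I : (Fin p → ℤ) → ℂ → ℂ,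
          (∀ s ∈ c.support, F.IsFeynmanIntegral D₀ x (ν + s) (I (ν + s))) →
          ∀ ε : ℂ, (∀ s ∈ c.support, AnalyticAt ℂ (I (ν + s)) ε) →
            (c.sum fun s b => Feynman.Coeff.eval b (fun e => (x e : ℂ)) ν ε *
              I (ν + s) ε) = 0) := by
  obtain ⟨l, r, h⟩ := hF.exists_reduces
  refine ⟨F.ibpCoeff l r D₀ i t, h.ibpCoeff_ne_zero D₀ i t, ?_, ?_⟩
  · intro d P m2 _ δ hδ ν k
    exact h.totalDerivative_eq D₀ i t P m2 hδ ν k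
  · intro x _ ν
    refine ⟨fun δ hδ => h.schwinger_relation D₀ i t x ν hδ, ?_⟩
    refine F.relation_of_isFeynmanIntegral D₀ _ x ν fun δ hδ => ?_
    obtain ⟨R, hR⟩ := h.schwinger_relation D₀ i t x ν hδ
    exact ⟨R, fun ε hε => (hR ε hε).2⟩
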